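/- Let $N\ge 1$. Fix a Littlewood–Paley decomposition of $\mathbb R^N$: a smooth radial $\chi:\mathbb R^N\to[0,1]$ with $\chi=1$ for $|\xi|\le 3/4$ and $\chi=0$ for $|\xi|\ge 4/3$, $\varphi(\xi)=\chi(\xi/2)-\chi(\xi)$, and, for tempered distributions $u\in\mathscr S'(\mathbb R^N)$ and $q\in\mathbb Z$, $\dot S_qu=\chi(2^{-q}D)u$ and $\dot\Delta_qu=\varphi(2^{-q}D)u$. Let $\mathscr S'_h$ be the space of $u\in\mathscr S'(\mathbb R^N)$ with $\dot S_qu\to0$ in $\mathscr S'$ as $q\to-\infty$. For $\sigma,s\in\mathbb R$, $\mu>0$ and $r\in[1,\infty]$ put $$\|u\|_{\dot B^\sigma_{2,1}}=\sum_{q\in\mathbb Z}2^{q\sigma}\|\dot\Delta_qu\|_{L^2},\qquad \|u\|_{\widetilde B^{s,r}_\mu}=\sum_{q\in\mathbb Z}2^{qs}\max\{\mu,2^{-q}\}^{1-\frac2r}\|\dot\Delta_qu\|_{L^2},$$ and let $\widetilde B^{s,r}_\mu$ be the set of $u\in\mathscr S'_h$ with $\|u\|_{\widetilde B^{s,r}_\mu}<\infty$.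 The paraproduct and the remainder are $$\dot T_uv=\sum_{q\in\mathbb Z}\dot S_{q-1}u\,\dot\Delta_qv,\qquad \dot R(u,v)=\sum_{|p-q|\le1}\dot\Delta_pu\,\dot\Delta_qv .$$ **Proposition 2.5.** Let $s,t\in\mathbb R$. There exists a constant $C>0$, independent of $\mu$, $u$ and $v$, such that for all $\mu>0$: 1. if $s\le\frac N2$, $u\in\widetilde B^{s,\infty}_\mu$ and $v\in\widetilde B^{t,1}_\mu$, then $$\|\dot T_uv\|_{\dot B^{s+t-\frac N2}_{2,1}}\le C\|u\|_{\widetilde B^{s,\infty}_\mu}\|v\|_{\widetilde B^{t,1}_\mu};$$ 2. if $s\le\frac N2-1$, $u\in\widetilde B^{s,1}_\mu$ and $v\in\widetilde B^{t,\infty}_\mu$, then $$\|\dot T_uv\|_{\dot B^{s+t-\frac N2}_{2,1}}\le C\|u\|_{\widetilde B^{s,1}_\mu}\|v\|_{\widetilde B^{t,\infty}_\mu};$$ 3. if $s+t>0$, $u\in\widetilde B^{s,\infty}_\mu$ and $v\in\widetilde B^{t,1}_\mu$, then $$\|\dot R(u,v)\|_{\dot B^{s+t-\frac N2}_{2,1}}\le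 C\|u\|_{\widetilde B^{s,\infty}_\mu}\|v\|_{\widetilde B^{t,1}_\mu}.$$ Here the left-hand sides are computed from the blocks $\dot\Delta_j\dot T_uv=\sum_q\dot\Delta_j(\dot S_{q-1}u\,\dot\Delta_qv)$ and $\dot\Delta_j\dot R(u,v)=\sum_{|p-q|\le1}\dot\Delta_j(\dot\Delta_pu\,\dot\Delta_qv)$, and it is part of the claim that these series converge in $\mathscr S'$ for every $j\in\mathbb Z$. If moreover $s+t\le N$, then the series defining $\dot T_uv$, respectively $\dot R(u,v)$, itself converges in $\mathscr S'$, and its sum lies in $\mathscr S'_h$ and satisfies the stated bound. -/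

import Mathlib

open MeasureTheory SchwartzMap Filter Topology
open scoped ENNReal ContDiff

noncomputable section

namespace HybridBesov

/-- The physical space `ℝ^N` with its Euclidean norm. -/
abbrev Rn (N : ℕ) : Type := EuclideanSpace ℝ (Fin N)

/-- The low-frequency cut-off `χ` of a Littlewood-Paley decomposition: a smooth radial function with
values in `[0, 1]`, supported in the ball of radius `4/3` and equal to `1` on the ball of radius
`3/4`. -/
structure LittlewoodPaley (N : ℕ) where
  χ : Rn N → ℝ
  smooth : ContDiff ℝ ∞ χ
  radial : ∀ ξ η, ‖ξ‖ = ‖η‖ → χ ξ = χ η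
  mem_Icc : ∀ ξ, χ ξ ∈ Set.Icc (0 : ℝ) 1
  eq_one : ∀ ξ, ‖ξ‖ ≤ 3 / 4 → χ ξ = 1
  eq_zero : ∀ ξ, 4 / 3 ≤ ‖ξ‖ → χ ξ = 0

/-- Littlewood-Paley cut-offs exist. -/
instance (N : ℕ) : Nonempty (LittlewoodPaley N) := by
  refine ⟨{ χ := fun ξ => Real.smoothTransition ((16 / 9 - ‖ξ‖ ^ 2) / (16 / 9 - 9 / 16))
            smooth := ?_, radial := ?_, mem_Icc := ?_, eq_one := ?_, eq_zero := ?_ }⟩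
  · exact Real.smoothTransition.contDiff.comp
      ((contDiff_const.sub (contDiff_norm_sq ℝ)).div_const _)
  · intro ξ η h
    simp only [h]
  · intro ξ
    exact ⟨Real.smoothTransition.nonneg _, Real.smoothTransition.le_one _⟩
  · intro ξ h
    apply Real.smoothTransition.one_of_one_le
    rw [le_div_iff₀ (by norm_num)]
    nlinarith [norm_nonneg ξ]
  · intro ξ h
    apply Real.smoothTransition.zero_of_nonpos
    apply div_nonpos_of_nonpos_of_nonneg _ (by norm_num)
    nlinarith [norm_nonneg ξ]

variable {N : ℕ}

namespace LittlewoodPaley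

/-- The function `φ(ξ) = χ(ξ/2) - χ(ξ)`, supported in the annulus `3/4 ≤ |ξ| ≤ 8/3`; one has
`∑_{q ∈ ℤ} φ(2^{-q} ξ) = 1` for `ξ ≠ 0`. -/
def φ (L : LittlewoodPaley N) (ξ : Rn N) : ℝ := L.χ ((2 : ℝ)⁻¹ • ξ) - L.χ ξ

/-- The low-frequency cut-off operator `S_q = χ(2^{-q} D)`, `D = -i∇`, on tempered distributions.
The factor `2π` translates the normalization `∫ e^{-2πi x·ξ} u(x) dx` of the Fourier transform in
Mathlib into the normalization `∫ e^{-i x·ξ} u(x) dx`. -/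
def S (L : LittlewoodPaley N) (q : ℤ) : 𝓢'(Rn N, ℂ) →L[ℂ] 𝓢'(Rn N, ℂ) :=
  TemperedDistribution.fourierMultiplierCLM ℂ
    (fun ξ : Rn N => ((L.χ ((2 * Real.pi * (2 : ℝ) ^ (-q)) • ξ) : ℝ) : ℂ))

/-- The homogeneous dyadic block `Δ_q = φ(2^{-q} D)`, `D = -i∇`, on tempered distributions. -/
def Δ (L : LittlewoodPaley N) (q : ℤ) : 𝓢'(Rn N, ℂ) →L[ℂ] 𝓢'(Rn N, ℂ) :=
  TemperedDistribution.fourierMultiplierCLM ℂ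
    (fun ξ : Rn N => ((L.φ ((2 * Real.pi * (2 : ℝ) ^ (-q)) • ξ) : ℝ) : ℂ))

/-- The space `𝓢'_h` of tempered distributions `u` with `S_q u → 0` in `𝓢'` as `q → -∞`. -/
def IsSh (L : LittlewoodPaley N) (u : 𝓢'(Rn N, ℂ)) : Prop :=
  Tendsto (fun q : ℤ => L.S q u) atBot (𝓝 0)

end LittlewoodPaley

/-- The `L²` norm of a tempered distribution: the norm of the `L²` function that represents it, and
`∞` if there is none. -/
def l2Norm (T : 𝓢'(Rn N, ℂ)) : ℝ≥0∞ :=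
  ⨅ (f : Lp ℂ 2 (volume : Measure (Rn N))) (_ : Lp.toTemperedDistribution f = T), ‖f‖ₑ

/-- The tempered distribution `T` is the function `f`. -/
def Represents (f : Rn N → ℂ) (T : 𝓢'(Rn N, ℂ)) : Prop :=
  ∀ h : 𝓢(Rn N, ℂ), Integrable (fun x => h x * f x) ∧ T h = ∫ x, h x * f x

/-- The function that represents a tempered distribution is unique almost everywhere. -/
theorem Represents.ae_eq {f g : Rn N → ℂ} {T : 𝓢'(Rn N, ℂ)} (hf : Represents f T)
    (hg : Represents g T) : f =ᵐ[volume] g := by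
  have loc : ∀ {k : Rn N → ℂ}, Represents k T → LocallyIntegrable k := by
    intro k hk x
    let b : ContDiffBump x := ⟨1, 2, by norm_num, by norm_num⟩
    have h1 : HasCompactSupport (Complex.ofRealCLM ∘ b) := b.hasCompactSupport.comp_left rfl
    have h2 : ContDiff ℝ ∞ (Complex.ofRealCLM ∘ b) := Complex.ofRealCLM.contDiff.comp b.contDiff
    refine ⟨Metric.closedBall x 1, Metric.closedBall_mem_nhds x one_pos, ?_⟩
    refine ((hk (h1.toSchwartzMap h2)).1.integrableOn (s := Metric.closedBall x 1)).congr_fun ?_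
      measurableSet_closedBall
    intro y hy
    have : b y = 1 := b.one_of_mem_closedBall hy
    simp [this]
  refine ae_eq_of_integral_contDiff_smul_eq (loc hf) (loc hg) fun w hw hc => ?_
  have h1 : HasCompactSupport (Complex.ofRealCLM ∘ w) := hc.comp_left rfl
  have h2 : ContDiff ℝ ∞ (Complex.ofRealCLM ∘ w) := Complex.ofRealCLM.contDiff.comp hw
  have h := (hf (h1.toSchwartzMap h2)).2.symm.trans (hg (h1.toSchwartzMap h2)).2
  simpa using h

/-- `W` is the product of `T₁` and `T₂`: these are functions, and `W` is their pointwise product. -/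
def IsProduct (T₁ T₂ W : 𝓢'(Rn N, ℂ)) : Prop :=
  ∃ f g : Rn N → ℂ, Represents f T₁ ∧ Represents g T₂ ∧ Represents (fun x => f x * g x) W

/-- The product does not depend on the representing functions. -/
theorem IsProduct.unique {T₁ T₂ W W' : 𝓢'(Rn N, ℂ)} (h : IsProduct T₁ T₂ W)
    (h' : IsProduct T₁ T₂ W') : W = W' := by
  obtain ⟨f, g, hf, hg, hW⟩ := h
  obtain ⟨f', g', hf', hg', hW'⟩ := h'
  ext k
  rw [(hW k).2, (hW' k).2]
  apply integral_congr_ae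
  filter_upwards [hf.ae_eq hf', hg.ae_eq hg'] with x h1 h2
  rw [h1, h2]

/-- The product of two tempered distributions that are functions. It is used below only for
distributions with compactly supported Fourier transform; these are smooth functions all of whose
derivatives have at most polynomial growth, so that their product is again a tempered
distribution. -/
def prod (T₁ T₂ : 𝓢'(Rn N, ℂ)) : 𝓢'(Rn N, ℂ) :=
  open Classical in if h : ∃ W, IsProduct T₁ T₂ W then h.choose else 0

namespace LittlewoodPaley

/-- The terms `S_{q-1}u Δ_q v`, `q ∈ ℤ`, of the paraproduct `T_u v`. -/
def paraTerm (L : LittlewoodPaley N) (u v : 𝓢'(Rn N, ℂ)) (q : ℤ) : 𝓢'(Rn N, ℂ) :=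
  prod (L.S (q - 1) u) (L.Δ q v)

/-- The terms `Δ_p u Δ_q v`, `|p - q| ≤ 1`, of the remainder `R(u, v)`. -/
def remTerm (L : LittlewoodPaley N) (u v : 𝓢'(Rn N, ℂ))
    (pq : {pq : ℤ × ℤ // |pq.1 - pq.2| ≤ 1}) : 𝓢'(Rn N, ℂ) :=
  prod (L.Δ pq.1.1 u) (L.Δ pq.1.2 v)

/-- The norm `∑_q 2^{qσ} ‖Δ_q T‖_{L²}` of the homogeneous Besov space `Ḃ^σ_{2,1}`. -/
def besovNorm (L : LittlewoodPaley N) (σ : ℝ) (T : 𝓢'(Rn N, ℂ)) : ℝ≥0∞ :=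
  ∑' q : ℤ, ENNReal.ofReal ((2 : ℝ) ^ ((q : ℝ) * σ)) * l2Norm (L.Δ q T)

/-- The hybrid norm `∑_q 2^{qs} max{μ, 2^{-q}}^{1 - 2/r} ‖Δ_q u‖_{L²}`. -/
def hybridNorm (L : LittlewoodPaley N) (μ s : ℝ) (r : ℝ≥0∞) (u : 𝓢'(Rn N, ℂ)) : ℝ≥0∞ :=
  ∑' q : ℤ, ENNReal.ofReal ((2 : ℝ) ^ ((q : ℝ) * s) *
    (max μ ((2 : ℝ) ^ (-q))) ^ (1 - 2 * (r⁻¹).toReal)) * l2Norm (L.Δ q u)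

/-- `u` belongs to the hybrid Besov space: it lies in `𝓢'_h` and has finite norm. -/
def MemHybrid (L : LittlewoodPaley N) (μ s : ℝ) (r : ℝ≥0∞) (u : 𝓢'(Rn N, ℂ)) : Prop :=
  L.IsSh u ∧ L.hybridNorm μ s r u < ⊤

/-- The sum of the series `∑_i F_i` of tempered distributions is in `Ḃ^σ_{2,1}`, with norm at most
`B`. Every block `Δ_q ∑_i F_i = ∑_i Δ_q F_i` converges in `𝓢'` and the norm computed from these
blocks is at most `B`. If `σ ≤ N/2`, the range in which `Ḃ^σ_{2,1}` is a space of distributions and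
not of distributions modulo polynomials, the series itself converges in `𝓢'` to an element of
`𝓢'_h`, whose norm is at most `B`. -/
def SumBesovBound (L : LittlewoodPaley N) {ι : Type} (σ : ℝ) (F : ι → 𝓢'(Rn N, ℂ))
    (B : ℝ≥0∞) : Prop :=
  (∀ q : ℤ, Summable (fun i => L.Δ q (F i))) ∧
  ∑' q : ℤ, ENNReal.ofReal ((2 : ℝ) ^ ((q : ℝ) * σ)) * l2Norm (∑' i, L.Δ q (F i)) ≤ B ∧
  (σ ≤ (N : ℝ) / 2 → ∃ T : 𝓢'(Rn N, ℂ), HasSum F T ∧ L.IsSh T ∧ L.besovNorm σ T ≤ B)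

end LittlewoodPaley

end HybridBesov

end

/-! Everything is done on the Fourier side. A block with finite `L²` norm has as Fourier transform
an `L²` function carried by a dyadic ring, hence an integrable one by Cauchy–Schwarz (Bernstein's
inequality, cost `2^{qN/2}`). Products thus become honest convolutions of integrable functions
(`Represents.fourier_prod`).

For the paraproduct, Young's inequality `L¹ ⋆ L² → L²` bounds the `q`-th term, which only meets the
blocks `q - 5 ≤ j ≤ q + 2`. For the remainder, `L² ⋆ L² → L^∞` bounds the transform of each term,
and block `j ≤ q + 3` then costs `2^{jN/2}`; the resulting geometric sum over `j` converges because
`s + t > 0`.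

The hybrid norms enter only through inequalities between weights. As `max{μ, 2^{-p}}` is
nonincreasing in `p`, the quotient of the factors at `p ≤ q` is at least `1` when `u` carries the
exponent `∞`. With the roles exchanged it may fall to `2^{p-q}`, and the extra unit in `s ≤ N/2 - 1`
pays for that. These inequalities hold uniformly in `μ`.

For convergence of the series itself when `σ ≤ N/2`, the weight `(1 + |ξ|²)^{-(N/2-σ)/2}` turns the
Besov bound into absolute convergence in `L¹` of the transforms. The transform of the sum is then a
function, without mass at the origin, which gives membership in `𝓢'_h`
(`sumBesovBound_of_represents`). -/

namespace HybridBesov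

/-! ### Distributions whose Fourier transform is a function -/

section Fourier

open scoped FourierTransform

variable {N : ℕ}

theorem Represents.eq {f : Rn N → ℂ} {T T' : 𝓢'(Rn N, ℂ)} (h : Represents f T)
    (h' : Represents f T') : T = T' := by
  ext k
  rw [(h k).2, (h' k).2]

theorem Represents.congr_ae {f g : Rn N → ℂ} {T : 𝓢'(Rn N, ℂ)} (h : Represents f T)
    (hfg : f =ᵐ[volume] g) : Represents g T := by
  intro k
  have e : (fun x => k x * f x) =ᵐ[volume] fun x => k x * g x := by
    filter_upwards [hfg] with x hx
    rw [hx]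
  exact ⟨(h k).1.congr e, (h k).2.trans (integral_congr_ae e)⟩

theorem represents_toLp {p : ℝ≥0∞} [hp : Fact (1 ≤ p)] {f : Rn N → ℂ}
    (hf : MemLp f p (volume : Measure (Rn N))) :
    Represents f (Lp.toTemperedDistribution (hf.toLp f)) := by
  intro h
  constructor
  · have := ENNReal.HolderConjugate.inv_one_sub_inv' hp.out
    exact MemLp.integrable_mul (h.memLp (1 - p⁻¹)⁻¹ volume) hf
  · rw [Lp.toTemperedDistribution_apply]
    apply integral_congr_ae
    filter_upwards [hf.coeFn_toLp] with x hx
    rw [hx, smul_eq_mul]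

theorem exists_represents_fourier {p : ℝ≥0∞} [hp : Fact (1 ≤ p)] {a : Rn N → ℂ}
    (ha : MemLp a p (volume : Measure (Rn N))) :
    ∃ T : 𝓢'(Rn N, ℂ), Represents a (𝓕 T) :=
  ⟨𝓕⁻ (Lp.toTemperedDistribution (ha.toLp a)), by
    rw [FourierTransform.fourier_fourierInv_eq]
    exact represents_toLp ha⟩

/-- Plancherel, together with the injectivity of `L² → 𝓢'`: the infimum defining `l2Norm` runs over
a single function. -/
theorem l2Norm_eq_eLpNorm {a : Rn N → ℂ} {T : 𝓢'(Rn N, ℂ)} (h : Represents a (𝓕 T))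
    (ha : MemLp a 2 (volume : Measure (Rn N))) : l2Norm T = eLpNorm a 2 volume := by
  have hT : Lp.toTemperedDistribution (𝓕⁻ (ha.toLp a)) = T := by
    rw [← Lp.fourierInv_toTemperedDistribution_eq, ← h.eq (represents_toLp ha),
      FourierTransform.fourierInv_fourier_eq]
  have hn : ‖(𝓕⁻ (ha.toLp a) : Lp ℂ 2 (volume : Measure (Rn N)))‖ₑ = eLpNorm a 2 volume := by
    have : ‖(𝓕⁻ (ha.toLp a) : Lp ℂ 2 (volume : Measure (Rn N)))‖ = ‖ha.toLp a‖ := by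
      rw [← Lp.norm_fourier_eq, FourierTransform.fourier_fourierInv_eq]
    rw [← enorm_norm, this, enorm_norm, Lp.enorm_toLp]
  apply le_antisymm
  · exact hn ▸ iInf₂_le (f := fun (f : Lp ℂ 2 (volume : Measure (Rn N)))
      (_ : Lp.toTemperedDistribution f = T) => ‖f‖ₑ) _ hT
  · refine le_iInf₂ fun f hf => ?_
    have : f = 𝓕⁻ (ha.toLp a) :=
      LinearMap.ker_eq_bot.mp (Lp.ker_toTemperedDistributionCLM_eq_bot (F := ℂ)
        (μ := (volume : Measure (Rn N))) (p := 2)) (hf.trans hT.symm)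
    rw [this, hn]

theorem exists_memLp_of_l2Norm_ne_top {T : 𝓢'(Rn N, ℂ)} (h : l2Norm T ≠ ⊤) :
    ∃ a, MemLp a 2 (volume : Measure (Rn N)) ∧ Represents a (𝓕 T) := by
  have : ∃ f : Lp ℂ 2 (volume : Measure (Rn N)), Lp.toTemperedDistribution f = T := by
    -- An infimum over the empty family is `⊤`.
    by_contra! hc
    apply h
    simp [l2Norm, hc]
  obtain ⟨f, rfl⟩ := this
  refine ⟨(𝓕 f : Lp ℂ 2 (volume : Measure (Rn N))), Lp.memLp _, ?_⟩
  rw [Lp.fourier_toTemperedDistribution_eq]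
  have := represents_toLp (Lp.memLp (𝓕 f))
  rwa [Lp.toLp_coeFn] at this

theorem Represents.smulLeftCLM {m a : Rn N → ℂ} {W : 𝓢'(Rn N, ℂ)} (h : Represents a W)
    (hm : m.HasTemperateGrowth) :
    Represents (fun ξ => m ξ * a ξ) (TemperedDistribution.smulLeftCLM ℂ m W) := by
  intro k
  have h1 := h (SchwartzMap.smulLeftCLM ℂ m k)
  simp only [SchwartzMap.smulLeftCLM_apply_apply hm, smul_eq_mul] at h1
  rw [TemperedDistribution.smulLeftCLM_apply_apply]
  have e : ∀ x, k x * (m x * a x) = m x * k x * a x := fun x => by ring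
  simp only [e]
  exact h1

theorem fourier_fourierMultiplierCLM (m : Rn N → ℂ) (T : 𝓢'(Rn N, ℂ)) :
    𝓕 (TemperedDistribution.fourierMultiplierCLM ℂ m T) =
      TemperedDistribution.smulLeftCLM ℂ m (𝓕 T) := by
  rw [TemperedDistribution.fourierMultiplierCLM_apply, FourierTransform.fourier_fourierInv_eq]

theorem Represents.fourierMultiplierCLM {m a : Rn N → ℂ} {T : 𝓢'(Rn N, ℂ)}
    (h : Represents a (𝓕 T)) (hm : m.HasTemperateGrowth) :
    Represents (fun ξ => m ξ * a ξ)
      (𝓕 (TemperedDistribution.fourierMultiplierCLM ℂ m T)) := by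
  rw [fourier_fourierMultiplierCLM]
  exact h.smulLeftCLM hm

theorem apply_eq_fourier_apply (T : 𝓢'(Rn N, ℂ)) (h : 𝓢(Rn N, ℂ)) :
    T h = (𝓕 T) (𝓕⁻ h) := by
  rw [TemperedDistribution.fourier_apply, FourierTransform.fourier_fourierInv_eq]

theorem continuous_neg_innerₗ : Continuous fun p : Rn N × Rn N => (-innerₗ (Rn N)) p.1 p.2 := by
  have : (fun p : Rn N × Rn N => (-innerₗ (Rn N)) p.1 p.2) = fun p => -inner ℝ p.1 p.2 := by
    ext p
    simp
  rw [this]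
  fun_prop

/-- Fubini; the inverse transform is its own transpose because the form `-⟨x, ξ⟩` is symmetric. -/
theorem integral_fourierInv_mul {f g : Rn N → ℂ} (hf : Integrable f) (hg : Integrable g) :
    ∫ x, 𝓕⁻ f x * g x = ∫ x, f x * 𝓕⁻ g x := by
  have := VectorFourier.integral_fourierIntegral_smul_eq_flip (μ := volume) (ν := volume)
    (L := -innerₗ (Rn N)) (f := f) (g := g) Real.continuous_fourierChar
    continuous_neg_innerₗ hf hg
  have e : ∀ k : Rn N → ℂ, 𝓕⁻ k = VectorFourier.fourierIntegral Real.fourierChar volume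
      (-innerₗ (Rn N)) k := fun k => rfl
  have hflip : (-innerₗ (Rn N)).flip = -innerₗ (Rn N) := by
    ext x y
    simp [real_inner_comm]
  rw [hflip] at this
  simpa only [e, smul_eq_mul] using this

theorem norm_fourierInv_le {f : Rn N → ℂ} (x : Rn N) : ‖𝓕⁻ f x‖ ≤ ∫ y, ‖f y‖ :=
  VectorFourier.norm_fourierIntegral_le_integral_norm _ _ _ _ _

theorem continuous_fourierInv {f : Rn N → ℂ} (hf : Integrable f) : Continuous (𝓕⁻ f) :=
  VectorFourier.fourierIntegral_continuous Real.continuous_fourierChar continuous_neg_innerₗ hf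

theorem Represents.fourierInv {a : Rn N → ℂ} {T : 𝓢'(Rn N, ℂ)}
    (h : Represents a (𝓕 T)) (ha : Integrable a) : Represents (𝓕⁻ a) T := by
  intro k
  constructor
  · exact (k.integrable (μ := volume)).mul_bdd (c := ∫ y, ‖a y‖)
      (continuous_fourierInv ha).aestronglyMeasurable (.of_forall fun x => norm_fourierInv_le x)
  · rw [apply_eq_fourier_apply, (h _).2, SchwartzMap.fourierInv_coe]
    exact (integral_fourierInv_mul k.integrable ha).trans rfl

open scoped Convolution in
theorem fourierInv_convolution {a b : Rn N → ℂ} (ha : Integrable a) (hb : Integrable b)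
    (x : Rn N) :
    𝓕⁻ (a ⋆[ContinuousLinearMap.mul ℂ ℂ] b) x = 𝓕⁻ a x * 𝓕⁻ b x := by
  simp only [Real.fourierInv_eq_fourier_neg]
  exact Real.fourier_mul_convolution_eq ha hb _

open scoped Convolution in
/-- The Fourier transform of a product is the convolution of the Fourier transforms. -/
theorem Represents.fourier_prod {a b : Rn N → ℂ} {T₁ T₂ : 𝓢'(Rn N, ℂ)}
    (h₁ : Represents a (𝓕 T₁)) (h₂ : Represents b (𝓕 T₂)) (ha : Integrable a)
    (hb : Integrable b) :
    Represents (a ⋆[ContinuousLinearMap.mul ℂ ℂ] b) (𝓕 (prod T₁ T₂)) := by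
  have hab : Integrable (a ⋆[ContinuousLinearMap.mul ℂ ℂ] b) := ha.integrable_convolution _ hb
  obtain ⟨W, hW⟩ := exists_represents_fourier (p := 1) (memLp_one_iff_integrable.2 hab)
  have hp : IsProduct T₁ T₂ W := by
    refine ⟨𝓕⁻ a, 𝓕⁻ b, h₁.fourierInv ha, h₂.fourierInv hb, ?_⟩
    have := hW.fourierInv hab
    rwa [funext (fourierInv_convolution ha hb)] at this
  -- The choice made in `prod` is forced to be `W` by uniqueness of products.
  have hex : ∃ W, IsProduct T₁ T₂ W := ⟨W, hp⟩
  have : prod T₁ T₂ = W := by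
    rw [HybridBesov.prod, dif_pos hex]
    exact hex.choose_spec.unique hp
  rwa [this]

/-- Multiplication by `m` kills every test function supported in `U`. This transfers the support of
a symbol to the function representing the transform. -/
theorem Represents.ae_eq_zero_of_isOpen {a m : Rn N → ℂ} {W : 𝓢'(Rn N, ℂ)} {U : Set (Rn N)}
    (h : Represents a (TemperedDistribution.smulLeftCLM ℂ m W)) (hm : m.HasTemperateGrowth)
    (ha : LocallyIntegrable a) (hU : IsOpen U) (hmU : ∀ ξ ∈ U, m ξ = 0) :
    ∀ᵐ ξ, ξ ∈ U → a ξ = 0 := by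
  refine hU.ae_eq_zero_of_integral_contDiff_smul_eq_zero (ha.locallyIntegrableOn _)
    fun g hg hgc hgU => ?_
  have h1 : HasCompactSupport (Complex.ofRealCLM ∘ g) := hgc.comp_left rfl
  have h2 : ContDiff ℝ ∞ (Complex.ofRealCLM ∘ g) := Complex.ofRealCLM.contDiff.comp hg
  have h3 := (h (h1.toSchwartzMap h2)).2
  have h4 : SchwartzMap.smulLeftCLM ℂ m (h1.toSchwartzMap h2) = 0 := by
    ext x
    rw [SchwartzMap.smulLeftCLM_apply_apply hm]
    by_cases hx : x ∈ U
    · simp [hmU x hx]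
    · have : g x = 0 := by
        by_contra hne
        exact hx (hgU (subset_tsupport _ hne))
      simp [this]
  rw [TemperedDistribution.smulLeftCLM_apply_apply, h4, map_zero] at h3
  simpa using h3.symm

end Fourier

/-! ### Absolutely convergent series on the Fourier side -/

section Series

open scoped FourierTransform

variable {N : ℕ}

/-- Completeness of `L^p` and continuity of `L^p → 𝓢'` and of `𝓕⁻`. The case `p = 2` sums blocks; `p
= 1` serves low frequencies and weighted transforms. -/
theorem exists_hasSum_of_tsum_eLpNorm {ι : Type*} {p : ℝ≥0∞} [hp : Fact (1 ≤ p)]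
    {f : ι → Rn N → ℂ} {F : ι → 𝓢'(Rn N, ℂ)} (hf : ∀ i, MemLp (f i) p volume)
    (hF : ∀ i, Represents (f i) (𝓕 (F i))) (hs : ∑' i, eLpNorm (f i) p volume ≠ ⊤) :
    ∃ g T, MemLp g p volume ∧ eLpNorm g p volume ≤ ∑' i, eLpNorm (f i) p volume ∧
      Represents g (𝓕 T) ∧ HasSum F T := by
  have hsum : Summable fun i => ‖(hf i).toLp (f i)‖ := by
    have : ∀ i, ‖(hf i).toLp (f i)‖ = (eLpNorm (f i) p volume).toReal := fun i => Lp.norm_toLp _ _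
    simp only [this]
    exact ENNReal.summable_toReal hs
  have h1 := hsum.of_norm.hasSum
  set g : Lp ℂ p (volume : Measure (Rn N)) := ∑' i, (hf i).toLp (f i) with hg
  have h2 := (FourierTransform.fourierInvCLM ℂ 𝓢'(Rn N, ℂ)).hasSum
    ((Lp.toTemperedDistributionCLM ℂ volume p).hasSum h1)
  have h3 : ∀ i, (FourierTransform.fourierInvCLM ℂ 𝓢'(Rn N, ℂ))
      (Lp.toTemperedDistributionCLM ℂ volume p ((hf i).toLp (f i))) = F i := fun i => by
    rw [Lp.toTemperedDistributionCLM_apply, ← (hF i).eq (represents_toLp (hf i))]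
    exact FourierTransform.fourierInv_fourier_eq (F := 𝓢'(Rn N, ℂ)) (F i)
  simp only [h3] at h2
  refine ⟨g, _, Lp.memLp g, ?_, ?_, h2⟩
  · rw [← Lp.enorm_def]
    refine enorm_tsum_le_tsum_enorm.trans_eq ?_
    exact tsum_congr fun i => Lp.enorm_toLp (hf i)
  · have h4 := represents_toLp (Lp.memLp g)
    rw [Lp.toLp_coeFn] at h4
    have h5 : 𝓕 ((FourierTransform.fourierInvCLM ℂ 𝓢'(Rn N, ℂ))
      (Lp.toTemperedDistributionCLM ℂ volume p g)) = Lp.toTemperedDistribution g :=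
      FourierTransform.fourier_fourierInv_eq _
    rwa [h5]

end Series

/-! ### Dyadic rings and Bernstein's inequality -/

variable {N : ℕ}

/-- The frequencies of the dyadic block of index `q`. -/
def freqRing (N : ℕ) (q : ℤ) : Set (Rn N) :=
  {ξ | 3 / 4 * (2 : ℝ) ^ q ≤ 2 * Real.pi * ‖ξ‖ ∧ 2 * Real.pi * ‖ξ‖ ≤ 8 / 3 * (2 : ℝ) ^ q}

theorem isClosed_freqRing (q : ℤ) : IsClosed (freqRing N q) := by
  have hc : Continuous fun ξ : Rn N => 2 * Real.pi * ‖ξ‖ := by fun_prop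
  exact (isClosed_le continuous_const hc).inter (isClosed_le hc continuous_const)

theorem measurableSet_freqRing (q : ℤ) : MeasurableSet (freqRing N q) :=
  (isClosed_freqRing q).measurableSet

theorem two_zpow_eq_rpow (q : ℤ) : ENNReal.ofReal ((2 : ℝ) ^ q) = (2 : ℝ≥0∞) ^ (q : ℝ) := by
  rw [← Real.rpow_intCast, ← ENNReal.ofReal_rpow_of_pos two_pos, ENNReal.ofReal_ofNat]

theorem volume_freqRing_le (q : ℤ) :
    volume (freqRing N q) ≤
      (2 : ℝ≥0∞) ^ ((q : ℝ) * N) * volume (Metric.closedBall (0 : Rn N) 1) := by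
  have h2 : (0 : ℝ) < 2 ^ q := by positivity
  -- The outer radius is `8 / (3 · 2π) < 1` times `2 ^ q`.
  have hsub : freqRing N q ⊆ Metric.closedBall 0 ((2 : ℝ) ^ q) := by
    intro ξ hξ
    rw [mem_closedBall_zero_iff]
    nlinarith [hξ.2, Real.pi_gt_three, norm_nonneg ξ]
  refine (measure_mono hsub).trans_eq ?_
  rw [Measure.addHaar_closedBall' _ _ h2.le, finrank_euclideanSpace_fin,
    ENNReal.ofReal_pow h2.le, two_zpow_eq_rpow, ← ENNReal.rpow_natCast, ← ENNReal.rpow_mul]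

theorem volume_freqRing_rpow_half_le (q : ℤ) :
    volume (freqRing N q) ^ (1 / 2 : ℝ) ≤
      (2 : ℝ≥0∞) ^ ((q : ℝ) * (N / 2)) *
        volume (Metric.closedBall (0 : Rn N) 1) ^ (1 / 2 : ℝ) := by
  refine (ENNReal.rpow_le_rpow (volume_freqRing_le q) (by norm_num)).trans_eq ?_
  rw [ENNReal.mul_rpow_of_nonneg _ _ (by norm_num), ← ENNReal.rpow_mul]
  congr 2
  ring

/-- The constant of the Bernstein inequality between `L¹` and `L²`, in frequency. -/
noncomputable def bernsteinConst (N : ℕ) : ℝ≥0∞ :=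
  volume (Metric.closedBall (0 : Rn N) 1) ^ (1 / 2 : ℝ)

theorem bernsteinConst_ne_top : bernsteinConst N ≠ ⊤ :=
  ENNReal.rpow_ne_top_of_nonneg (by norm_num)
    (isCompact_closedBall (0 : Rn N) 1).measure_lt_top.ne

/-- Cauchy–Schwarz on the ring, whose volume is at most a constant times `2^{qN}`. -/
theorem lintegral_enorm_le_of_freqRing {a : Rn N → ℂ} {q : ℤ}
    (ha : AEStronglyMeasurable a volume) (h0 : ∀ ξ, ξ ∉ freqRing N q → a ξ = 0) :
    ∫⁻ ξ, ‖a ξ‖ₑ ≤ bernsteinConst N * (2 : ℝ≥0∞) ^ ((q : ℝ) * (N / 2)) * eLpNorm a 2 volume := by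
  have h1 : ∫⁻ ξ, ‖a ξ‖ₑ = ∫⁻ ξ in freqRing N q, ‖a ξ‖ₑ := by
    rw [← lintegral_indicator (measurableSet_freqRing q)]
    refine lintegral_congr fun ξ => ?_
    by_cases hξ : ξ ∈ freqRing N q
    · simp [hξ]
    · simp [hξ, h0 ξ hξ]
  have h2 := eLpNorm_le_eLpNorm_mul_rpow_measure_univ (p := 1) (q := 2)
    (μ := volume.restrict (freqRing N q)) (by norm_num) ha.restrict
  rw [eLpNorm_one_eq_lintegral_enorm, ← h1, Measure.restrict_apply_univ] at h2
  have e : (1 / (1 : ℝ≥0∞).toReal - 1 / (2 : ℝ≥0∞).toReal) = (1 / 2 : ℝ) := by norm_num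
  rw [e] at h2
  refine h2.trans ?_
  rw [mul_comm (eLpNorm _ _ _)]
  refine mul_le_mul' ((volume_freqRing_rpow_half_le q).trans_eq (mul_comm _ _)) ?_
  exact eLpNorm_mono_measure _ Measure.restrict_le_self

/-! ### Symbols, telescoping, and transforms of blocks and low frequencies -/

namespace LittlewoodPaley

variable (L : LittlewoodPaley N)

/-- The symbol of `S_q`. -/
noncomputable def lowSymbol (q : ℤ) (ξ : Rn N) : ℝ := L.χ ((2 * Real.pi * (2 : ℝ) ^ (-q)) • ξ)

/-- The symbol of `Δ_q`. -/
noncomputable def blockSymbol (q : ℤ) (ξ : Rn N) : ℝ := L.φ ((2 * Real.pi * (2 : ℝ) ^ (-q)) • ξ)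

theorem S_apply (q : ℤ) (u : 𝓢'(Rn N, ℂ)) : L.S q u =
    TemperedDistribution.fourierMultiplierCLM ℂ (fun ξ => (L.lowSymbol q ξ : ℂ)) u := rfl

theorem Δ_apply (q : ℤ) (u : 𝓢'(Rn N, ℂ)) : L.Δ q u =
    TemperedDistribution.fourierMultiplierCLM ℂ (fun ξ => (L.blockSymbol q ξ : ℂ)) u := rfl

theorem norm_dilate (q : ℤ) (ξ : Rn N) :
    ‖(2 * Real.pi * (2 : ℝ) ^ (-q)) • ξ‖ = 2 * Real.pi * ‖ξ‖ / 2 ^ q := by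
  rw [norm_smul, Real.norm_of_nonneg (by positivity), zpow_neg]
  ring

theorem lowSymbol_eq_one {q : ℤ} {ξ : Rn N} (h : 2 * Real.pi * ‖ξ‖ ≤ 3 / 4 * 2 ^ q) :
    L.lowSymbol q ξ = 1 := by
  apply L.eq_one
  rwa [norm_dilate, div_le_iff₀ (by positivity)]

theorem lowSymbol_eq_zero {q : ℤ} {ξ : Rn N} (h : 4 / 3 * 2 ^ q ≤ 2 * Real.pi * ‖ξ‖) :
    L.lowSymbol q ξ = 0 := by
  apply L.eq_zero
  rwa [norm_dilate, le_div_iff₀ (by positivity)]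

theorem lowSymbol_mem_Icc (q : ℤ) (ξ : Rn N) : L.lowSymbol q ξ ∈ Set.Icc (0 : ℝ) 1 :=
  L.mem_Icc _

theorem blockSymbol_eq_sub (q : ℤ) (ξ : Rn N) :
    L.blockSymbol q ξ = L.lowSymbol (q + 1) ξ - L.lowSymbol q ξ := by
  rw [blockSymbol, φ, lowSymbol, lowSymbol, smul_smul]
  congr 3
  rw [neg_add, zpow_add₀ two_ne_zero, zpow_neg_one]
  ring

theorem norm_blockSymbol_le (q : ℤ) (ξ : Rn N) : ‖(L.blockSymbol q ξ : ℂ)‖ ≤ 1 := by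
  have h := L.lowSymbol_mem_Icc q ξ
  have h' := L.lowSymbol_mem_Icc (q + 1) ξ
  rw [Complex.norm_real, blockSymbol_eq_sub, Real.norm_eq_abs, abs_le]
  constructor <;> linarith [h.1, h.2, h'.1, h'.2]

theorem blockSymbol_eq_zero {q : ℤ} {ξ : Rn N} (h : ξ ∉ freqRing N q) :
    L.blockSymbol q ξ = 0 := by
  have h2 : (0 : ℝ) < 2 ^ q := by positivity
  have h3 : (2 : ℝ) ^ (q + 1) = 2 ^ q * 2 := zpow_add_one₀ two_ne_zero q
  rw [blockSymbol_eq_sub]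
  by_cases h1 : 3 / 4 * (2 : ℝ) ^ q ≤ 2 * Real.pi * ‖ξ‖
  · have h4 : 8 / 3 * (2 : ℝ) ^ q < 2 * Real.pi * ‖ξ‖ := by
      by_contra hc
      exact h ⟨h1, not_lt.1 hc⟩
    rw [L.lowSymbol_eq_zero (by rw [h3]; linarith), L.lowSymbol_eq_zero (by linarith), sub_zero]
  · rw [L.lowSymbol_eq_one (by rw [h3]; linarith), L.lowSymbol_eq_one (by linarith), sub_self]

theorem contDiff_lowSymbol (q : ℤ) : ContDiff ℝ ∞ (L.lowSymbol q) :=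
  L.smooth.comp (contDiff_const_smul _)

theorem hasTemperateGrowth_lowSymbol (q : ℤ) :
    (fun ξ => (L.lowSymbol q ξ : ℂ)).HasTemperateGrowth := by
  have hc : HasCompactSupport (fun ξ => (L.lowSymbol q ξ : ℂ)) := by
    refine HasCompactSupport.of_support_subset_isCompact
      (isCompact_closedBall (0 : Rn N) (4 / 3 * 2 ^ q)) fun ξ hξ => ?_
    rw [mem_closedBall_zero_iff]
    by_contra hlt
    apply hξ
    have := L.lowSymbol_eq_zero (q := q) (ξ := ξ)
      (by nlinarith [Real.pi_gt_three, norm_nonneg ξ])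
    simp [this]
  exact hc.hasTemperateGrowth (Complex.ofRealCLM.contDiff.comp (L.contDiff_lowSymbol q))

theorem hasTemperateGrowth_blockSymbol (q : ℤ) :
    (fun ξ => (L.blockSymbol q ξ : ℂ)).HasTemperateGrowth := by
  have : (fun ξ => (L.blockSymbol q ξ : ℂ)) =
      (fun ξ => (L.lowSymbol (q + 1) ξ : ℂ)) - fun ξ => (L.lowSymbol q ξ : ℂ) := by
    ext ξ
    simp [blockSymbol_eq_sub]
  rw [this]
  exact (L.hasTemperateGrowth_lowSymbol _).sub (L.hasTemperateGrowth_lowSymbol _)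

theorem Δ_eq_sub (q : ℤ) (u : 𝓢'(Rn N, ℂ)) : L.Δ q u = L.S (q + 1) u - L.S q u := by
  have : (fun ξ => (L.blockSymbol q ξ : ℂ)) =
      (fun ξ => (L.lowSymbol (q + 1) ξ : ℂ)) - fun ξ => (L.lowSymbol q ξ : ℂ) := by
    ext ξ
    simp [blockSymbol_eq_sub]
  rw [Δ_apply, S_apply, S_apply, TemperedDistribution.fourierMultiplierCLM_apply, this,
    TemperedDistribution.smulLeftCLM_sub (L.hasTemperateGrowth_lowSymbol _)
      (L.hasTemperateGrowth_lowSymbol _), sub_apply]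
  exact map_sub (FourierTransform.fourierInvCLM ℂ 𝓢'(Rn N, ℂ)) _ _

/-- Telescoping. For `u` in `𝓢'_h` the last term vanishes in the limit, which recovers `S_r u` from
the blocks below `r`. -/
theorem sum_Δ_eq (r : ℤ) (n : ℕ) (u : 𝓢'(Rn N, ℂ)) :
    ∑ k ∈ Finset.range n, L.Δ (r - 1 - k) u = L.S r u - L.S (r - n) u := by
  induction n with
  | zero => simp
  | succ n ih =>
    rw [Finset.sum_range_succ, ih, Δ_eq_sub]
    have e1 : r - 1 - n + 1 = r - (n : ℤ) := by ring
    have e2 : r - 1 - n = r - ((n + 1 : ℕ) : ℤ) := by push_cast; ring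
    rw [e1, e2]
    abel

theorem sum_blockSymbol_eq (r : ℤ) (n : ℕ) (ξ : Rn N) :
    ∑ k ∈ Finset.range n, L.blockSymbol (r + k) ξ = L.lowSymbol (r + n) ξ - L.lowSymbol r ξ := by
  induction n with
  | zero => simp
  | succ n ih =>
    rw [Finset.sum_range_succ, ih, blockSymbol_eq_sub]
    push_cast
    rw [add_assoc r]
    ring

theorem exists_int_two_zpow_lt {ε : ℝ} (hε : 0 < ε) : ∃ m : ℤ, ∀ q ≤ m, (2 : ℝ) ^ q < ε := by
  obtain ⟨n, hn⟩ := exists_pow_lt_of_lt_one hε (by norm_num : (2⁻¹ : ℝ) < 1)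
  refine ⟨-n, fun q hq => lt_of_le_of_lt (zpow_le_zpow_right₀ one_le_two hq) ?_⟩
  rwa [zpow_neg, zpow_natCast, ← inv_pow]

theorem eventually_lowSymbol_eq_zero {ξ : Rn N} (hξ : ξ ≠ 0) :
    ∀ᶠ q in atBot, L.lowSymbol q ξ = 0 := by
  obtain ⟨m, hm⟩ := exists_int_two_zpow_lt (norm_pos_iff.2 hξ)
  filter_upwards [eventually_le_atBot m] with q hq
  apply L.lowSymbol_eq_zero
  nlinarith [hm q hq, Real.pi_gt_three, norm_nonneg ξ]

/-- A finite sum of symbols telescopes to `1 - 0` once its range extends far enough on both sides of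
`|ξ|`. This half of the partition of unity suffices for upper bounds by blocks. -/
theorem one_le_tsum_blockSymbol {ξ : Rn N} (hξ : ξ ≠ 0) :
    1 ≤ ∑' q : ℤ, ‖(L.blockSymbol q ξ : ℂ)‖ₑ := by
  obtain ⟨r, hr⟩ := (L.eventually_lowSymbol_eq_zero hξ).exists
  obtain ⟨m, hm⟩ := pow_unbounded_of_one_lt (‖ξ‖ * 16 * 2 ^ (-r)) (one_lt_two (α := ℝ))
  have h1 : L.lowSymbol (r + m) ξ = 1 := by
    apply L.lowSymbol_eq_one
    rw [zpow_add₀ two_ne_zero, zpow_natCast]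
    have h2 : (0 : ℝ) < 2 ^ r := by positivity
    rw [zpow_neg, ← div_eq_mul_inv, div_lt_iff₀ h2] at hm
    nlinarith [Real.pi_lt_four, norm_nonneg ξ]
  have h2 := L.sum_blockSymbol_eq r m ξ
  rw [h1, hr, sub_zero] at h2
  calc (1 : ℝ≥0∞) = ‖∑ k ∈ Finset.range m, (L.blockSymbol (r + k) ξ : ℂ)‖ₑ := by
        rw [← Complex.ofReal_sum, h2]; simp
    _ ≤ ∑ k ∈ Finset.range m, ‖(L.blockSymbol (r + k) ξ : ℂ)‖ₑ := enorm_sum_le _ _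
    _ ≤ ∑' k : ℕ, ‖(L.blockSymbol (r + k) ξ : ℂ)‖ₑ := ENNReal.sum_le_tsum _
    _ ≤ _ := ENNReal.tsum_comp_le_tsum_of_injective (f := fun k : ℕ => r + (k : ℤ))
        (fun a b h => by simpa using h) (fun q => ‖(L.blockSymbol q ξ : ℂ)‖ₑ)

open scoped FourierTransform

theorem S_apply_apply {a : Rn N → ℂ} {T : 𝓢'(Rn N, ℂ)} (h : Represents a (𝓕 T)) (q : ℤ)
    (k : 𝓢(Rn N, ℂ)) :
    L.S q T k = ∫ ξ, (L.lowSymbol q ξ : ℂ) * ((𝓕⁻ k) ξ * a ξ) := by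
  rw [S_apply, apply_eq_fourier_apply,
    (h.fourierMultiplierCLM (L.hasTemperateGrowth_lowSymbol q) _).2]
  refine integral_congr_ae (.of_forall fun ξ => ?_)
  exact mul_left_comm _ _ _

/-- Dominated convergence: the symbols tend to `0` off the origin, which is a null set because `N ≥
1`. -/
theorem tendsto_integral_lowSymbol_mul (hN : 1 ≤ N) {b : Rn N → ℂ} (hb : Integrable b) :
    Tendsto (fun q : ℤ => ∫ ξ, (L.lowSymbol q ξ : ℂ) * b ξ) atBot (𝓝 0) := by
  have : Nonempty (Fin N) := ⟨⟨0, hN⟩⟩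
  have h0 : ∀ᵐ ξ : Rn N, ξ ≠ 0 := Measure.ae_ne volume 0
  rw [← integral_zero (Rn N) ℂ (μ := volume)]
  refine tendsto_integral_filter_of_dominated_convergence (fun ξ => ‖b ξ‖) ?_ ?_ hb.norm ?_
  · refine .of_forall fun q => ?_
    exact (L.hasTemperateGrowth_lowSymbol q).1.continuous.aestronglyMeasurable.mul hb.1
  · refine .of_forall fun q => .of_forall fun ξ => ?_
    rw [norm_mul]
    refine mul_le_of_le_one_left (norm_nonneg _) ?_
    have := L.lowSymbol_mem_Icc q ξ
    rw [Complex.norm_real, Real.norm_of_nonneg this.1]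
    exact this.2
  · filter_upwards [h0] with ξ hξ
    refine tendsto_const_nhds.congr' ?_
    filter_upwards [L.eventually_lowSymbol_eq_zero hξ] with q hq
    rw [hq, Complex.ofReal_zero, zero_mul]

/-- A tempered distribution whose Fourier transform is a function belongs to `𝓢'_h`. -/
theorem isSh_of_represents (hN : 1 ≤ N) {a : Rn N → ℂ} {T : 𝓢'(Rn N, ℂ)}
    (h : Represents a (𝓕 T)) : L.IsSh T := by
  refine PointwiseConvergenceCLM.tendsto_iff_forall_tendsto.2 fun k => ?_
  have h1 := L.tendsto_integral_lowSymbol_mul hN (h (𝓕⁻ k)).1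
  exact h1.congr fun q => (L.S_apply_apply h q k).symm

/-- The Fourier transform of a block in `L²`. -/
theorem exists_fourier_Δ {u : 𝓢'(Rn N, ℂ)} {q : ℤ} (h : l2Norm (L.Δ q u) ≠ ⊤) :
    ∃ a : Rn N → ℂ, MemLp a 2 volume ∧ Integrable a ∧ Represents a (𝓕 (L.Δ q u)) ∧
      (∀ ξ, ξ ∉ freqRing N q → a ξ = 0) ∧ eLpNorm a 2 volume = l2Norm (L.Δ q u) ∧
      eLpNorm a 1 volume ≤
        bernsteinConst N * (2 : ℝ≥0∞) ^ ((q : ℝ) * (N / 2)) * l2Norm (L.Δ q u) := by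
  obtain ⟨b, hb, hbr⟩ := exists_memLp_of_l2Norm_ne_top h
  have hU : IsOpen (freqRing N q)ᶜ := (isClosed_freqRing q).isOpen_compl
  have hz : ∀ᵐ ξ, ξ ∈ (freqRing N q)ᶜ → b ξ = 0 := by
    have hbr' := hbr
    rw [Δ_apply, fourier_fourierMultiplierCLM] at hbr'
    refine hbr'.ae_eq_zero_of_isOpen (L.hasTemperateGrowth_blockSymbol q)
      (hb.locallyIntegrable (by norm_num)) hU fun ξ hξ => ?_
    rw [L.blockSymbol_eq_zero hξ, Complex.ofReal_zero]
  -- Truncation makes the vanishing pointwise, as the support argument for convolutions requires.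
  have hab : b =ᵐ[volume] (freqRing N q).indicator b := by
    filter_upwards [hz] with ξ hξ
    by_cases hm : ξ ∈ freqRing N q
    · simp [hm]
    · simp [hm, hξ hm]
  have ha : MemLp ((freqRing N q).indicator b) 2 volume :=
    hb.indicator (measurableSet_freqRing q)
  have hr := hbr.congr_ae hab
  have h0 : ∀ ξ, ξ ∉ freqRing N q → (freqRing N q).indicator b ξ = 0 :=
    fun ξ hξ => Set.indicator_of_notMem hξ _
  have h2 := (l2Norm_eq_eLpNorm hr ha).symm
  have h1 := lintegral_enorm_le_of_freqRing ha.1 h0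
  rw [h2, ← eLpNorm_one_eq_lintegral_enorm] at h1
  refine ⟨_, ha, ?_, hr, h0, h2, h1⟩
  refine memLp_one_iff_integrable.1 ⟨ha.1, h1.trans_lt ?_⟩
  exact ENNReal.mul_lt_top (ENNReal.mul_lt_top bernsteinConst_ne_top.lt_top
    (ENNReal.rpow_ne_top_of_ne_zero (by norm_num) (by norm_num)).lt_top) h.lt_top

/-- The Fourier transform of the low frequencies of an element of `𝓢'_h`. -/
theorem exists_fourier_S {u : 𝓢'(Rn N, ℂ)} (hu : L.IsSh u) {r : ℤ}
    (h : ∀ q, l2Norm (L.Δ q u) ≠ ⊤)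
    (hs : ∑' n : ℕ, (2 : ℝ≥0∞) ^ (((r - 1 - n : ℤ) : ℝ) * (N / 2)) *
      l2Norm (L.Δ (r - 1 - n) u) ≠ ⊤) :
    ∃ a : Rn N → ℂ, Integrable a ∧ Represents a (𝓕 (L.S r u)) ∧
      (∀ ξ, 4 / 3 * (2 : ℝ) ^ r < 2 * Real.pi * ‖ξ‖ → a ξ = 0) ∧
      eLpNorm a 1 volume ≤ bernsteinConst N * ∑' n : ℕ,
        (2 : ℝ≥0∞) ^ (((r - 1 - n : ℤ) : ℝ) * (N / 2)) * l2Norm (L.Δ (r - 1 - n) u) := by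
  choose a ha2 ha hr ha0 hn2 hn1 using fun n : ℕ => L.exists_fourier_Δ (h (r - 1 - n))
  have hle : ∑' n, eLpNorm (a n) 1 volume ≤ bernsteinConst N * ∑' n : ℕ,
      (2 : ℝ≥0∞) ^ (((r - 1 - n : ℤ) : ℝ) * (N / 2)) * l2Norm (L.Δ (r - 1 - n) u) := by
    rw [← ENNReal.tsum_mul_left]
    exact ENNReal.tsum_le_tsum fun n => (hn1 n).trans_eq (mul_assoc _ _ _)
  obtain ⟨g, T, hg, hgn, hgr, hT⟩ := exists_hasSum_of_tsum_eLpNorm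
    (fun n => memLp_one_iff_integrable.2 (ha n)) hr
    (ne_top_of_le_ne_top (ENNReal.mul_ne_top bernsteinConst_ne_top hs) hle)
  -- Here `u ∈ 𝓢'_h` is essential: it removes the tail `S_{r-n} u` of the telescoping sum.
  have hTS : T = L.S r u := by
    refine tendsto_nhds_unique hT.tendsto_sum_nat ?_
    simp only [sum_Δ_eq]
    have h1 : Tendsto (fun n : ℕ => r - (n : ℤ)) atTop atBot :=
      tendsto_atBot_add_const_left atTop r
        (tendsto_neg_atTop_atBot.comp tendsto_natCast_atTop_atTop)
    have h2 : Tendsto (fun n : ℕ => L.S (r - (n : ℤ)) u) atTop (𝓝 0) :=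
      Tendsto.comp (g := fun q => L.S q u) hu h1
    simpa using tendsto_const_nhds.sub h2
  rw [hTS] at hgr
  have hU : IsOpen {ξ : Rn N | 4 / 3 * (2 : ℝ) ^ r < 2 * Real.pi * ‖ξ‖} :=
    isOpen_lt (by fun_prop) (by fun_prop)
  have hz : ∀ᵐ ξ, ξ ∈ {ξ : Rn N | 4 / 3 * (2 : ℝ) ^ r < 2 * Real.pi * ‖ξ‖} → g ξ = 0 := by
    have hgr' := hgr
    rw [S_apply, fourier_fourierMultiplierCLM] at hgr'
    refine hgr'.ae_eq_zero_of_isOpen (L.hasTemperateGrowth_lowSymbol r)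
      (hg.locallyIntegrable (by norm_num)) hU fun ξ hξ => ?_
    rw [L.lowSymbol_eq_zero (le_of_lt hξ), Complex.ofReal_zero]
  have hab : g =ᵐ[volume]
      {ξ : Rn N | 4 / 3 * (2 : ℝ) ^ r < 2 * Real.pi * ‖ξ‖}ᶜ.indicator g := by
    filter_upwards [hz] with ξ hξ
    by_cases hm : ξ ∈ {ξ : Rn N | 4 / 3 * (2 : ℝ) ^ r < 2 * Real.pi * ‖ξ‖}
    · rw [Set.indicator_of_notMem (by simpa using hm), hξ hm]
    · rw [Set.indicator_of_mem (by simpa using hm)]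
  refine ⟨_, (memLp_one_iff_integrable.1 hg).congr hab, hgr.congr_ae hab, fun ξ hξ => ?_, ?_⟩
  · exact Set.indicator_of_notMem (by simpa using hξ) _
  · rw [← eLpNorm_congr_ae hab]
    exact hgn.trans hle

end LittlewoodPaley

/-! ### From block bounds to convergence in `𝓢'` -/

variable {N : ℕ}

theorem ofReal_two_rpow (x : ℝ) : ENNReal.ofReal ((2 : ℝ) ^ x) = (2 : ℝ≥0∞) ^ x := by
  rw [← ENNReal.ofReal_rpow_of_pos two_pos, ENNReal.ofReal_ofNat]

/-- The weight `(1 + |ξ|²)^r`. -/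
noncomputable def japanese (N : ℕ) (r : ℝ) (ξ : Rn N) : ℂ := (((1 + ‖ξ‖ ^ 2) ^ r : ℝ) : ℂ)

theorem hasTemperateGrowth_japanese (r : ℝ) : (japanese N r).HasTemperateGrowth :=
  Function.Complex.hasTemperateGrowth_ofReal.comp
    (Function.hasTemperateGrowth_one_add_norm_sq_rpow (Rn N) r)

theorem japanese_mul_japanese_neg (r : ℝ) : japanese N (-r) * japanese N r = fun _ => 1 := by
  ext ξ
  have h : (0 : ℝ) < 1 + ‖ξ‖ ^ 2 := by positivity
  rw [Pi.mul_apply, japanese, japanese, ← Complex.ofReal_mul, ← Real.rpow_add h]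
  simp

theorem enorm_japanese_neg_le {r : ℝ} (hr : 0 ≤ r) {j : ℤ} {ξ : Rn N} (hξ : ξ ∈ freqRing N j) :
    ‖japanese N (-r) ξ‖ₑ ≤ ENNReal.ofReal (256 ^ r) * (2 : ℝ≥0∞) ^ (-((j : ℝ) * (2 * r))) := by
  have h2 : (0 : ℝ) < 2 ^ j := by positivity
  -- From `2π < 8` and `3/4 ≥ 8/16`; the constant `256` is `16²`.
  have hx : (2 : ℝ) ^ j / 16 ≤ ‖ξ‖ := by
    nlinarith [hξ.1, Real.pi_lt_four, norm_nonneg ξ]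
  have h1 : ((1 + ‖ξ‖ ^ 2) ^ (-r) : ℝ) ≤ (((2 : ℝ) ^ j / 16) ^ 2) ^ (-r) := by
    apply Real.rpow_le_rpow_of_nonpos (by positivity) _ (by linarith)
    have := pow_le_pow_left₀ (by positivity) hx 2
    linarith
  have h3 : (((2 : ℝ) ^ j / 16) ^ 2) ^ (-r) = 256 ^ r * (2 : ℝ) ^ (-((j : ℝ) * (2 * r))) := by
    rw [div_pow, Real.div_rpow (sq_nonneg _) (by norm_num), ← Real.rpow_intCast,
      ← Real.rpow_natCast, ← Real.rpow_mul two_pos.le, ← Real.rpow_mul two_pos.le,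
      Real.rpow_neg (by norm_num : (0 : ℝ) ≤ 16 ^ 2), div_inv_eq_mul, mul_comm]
    congr 2
    · norm_num
    · push_cast
      ring
  rw [← ofReal_norm, japanese, Complex.norm_real, Real.norm_of_nonneg (by positivity)]
  refine (ENNReal.ofReal_le_ofReal (h1.trans_eq h3)).trans_eq ?_
  rw [ENNReal.ofReal_mul (by positivity), ← ENNReal.ofReal_rpow_of_pos two_pos,
    ENNReal.ofReal_ofNat]

namespace LittlewoodPaley

variable (L : LittlewoodPaley N)

open scoped FourierTransform

/-- On ring `j` the weight is at most a constant times `2^{-j(N/2-σ)}`, which turns the Bernstein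
factor `2^{jN/2}` into `2^{jσ}`. -/
theorem lintegral_japanese_mul_le {σ : ℝ} (hσ : σ ≤ (N : ℝ) / 2) {c : Rn N → ℂ}
    (hc : AEStronglyMeasurable c volume) (j : ℤ) :
    ∫⁻ ξ, ‖japanese N (-((N / 2 - σ) / 2)) ξ‖ₑ * ‖(L.blockSymbol j ξ : ℂ) * c ξ‖ₑ ≤
      ENNReal.ofReal (256 ^ ((N / 2 - σ) / 2)) * bernsteinConst N * ((2 : ℝ≥0∞) ^ ((j : ℝ) * σ) *
        eLpNorm (fun ξ => (L.blockSymbol j ξ : ℂ) * c ξ) 2 volume) := by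
  set r : ℝ := (N / 2 - σ) / 2 with hr
  have hr0 : 0 ≤ r := by rw [hr]; linarith
  have h1 : ∀ ξ, ‖japanese N (-r) ξ‖ₑ * ‖(L.blockSymbol j ξ : ℂ) * c ξ‖ₑ ≤
      (ENNReal.ofReal (256 ^ r) * (2 : ℝ≥0∞) ^ (-((j : ℝ) * (2 * r)))) *
        ‖(L.blockSymbol j ξ : ℂ) * c ξ‖ₑ := fun ξ => by
    by_cases hξ : ξ ∈ freqRing N j
    · exact mul_le_mul_left (enorm_japanese_neg_le hr0 hξ) _
    · simp [L.blockSymbol_eq_zero hξ]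
  refine (lintegral_mono h1).trans ?_
  have htop : ENNReal.ofReal (256 ^ r) * (2 : ℝ≥0∞) ^ (-((j : ℝ) * (2 * r))) ≠ ⊤ :=
    ENNReal.mul_ne_top ENNReal.ofReal_ne_top
      (ENNReal.rpow_ne_top_of_ne_zero (by norm_num) (by norm_num))
  rw [lintegral_const_mul' _ _ htop]
  have hm : AEStronglyMeasurable (fun ξ => (L.blockSymbol j ξ : ℂ) * c ξ) volume :=
    (L.hasTemperateGrowth_blockSymbol j).1.continuous.aestronglyMeasurable.mul hc
  refine (mul_le_mul_right (lintegral_enorm_le_of_freqRing (q := j) hm fun ξ hξ => by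
    simp [L.blockSymbol_eq_zero hξ]) _).trans_eq ?_
  have e : (2 : ℝ≥0∞) ^ ((j : ℝ) * σ) =
      (2 : ℝ≥0∞) ^ (-((j : ℝ) * (2 * r))) * (2 : ℝ≥0∞) ^ ((j : ℝ) * (N / 2)) := by
    rw [← ENNReal.rpow_add _ _ (by norm_num) (by norm_num)]
    congr 1
    rw [hr]
    ring
  rw [e]
  ring

theorem eLpNorm_japanese_mul_le (hN : 1 ≤ N) {σ : ℝ} (hσ : σ ≤ (N : ℝ) / 2) {c : Rn N → ℂ}
    (hc : AEStronglyMeasurable c volume) :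
    eLpNorm (fun ξ => japanese N (-((N / 2 - σ) / 2)) ξ * c ξ) 1 volume ≤
      ENNReal.ofReal (256 ^ ((N / 2 - σ) / 2)) * bernsteinConst N * ∑' j : ℤ,
        (2 : ℝ≥0∞) ^ ((j : ℝ) * σ) *
          eLpNorm (fun ξ => (L.blockSymbol j ξ : ℂ) * c ξ) 2 volume := by
  have : Nonempty (Fin N) := ⟨⟨0, hN⟩⟩
  set w := japanese N (-((N / 2 - σ) / 2)) with hw
  have h0 : ∀ᵐ ξ : Rn N, ξ ≠ 0 := Measure.ae_ne volume 0
  rw [eLpNorm_one_eq_lintegral_enorm, ← ENNReal.tsum_mul_left]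
  calc ∫⁻ ξ, ‖w ξ * c ξ‖ₑ ≤ ∫⁻ ξ, ∑' j : ℤ, ‖w ξ‖ₑ * ‖(L.blockSymbol j ξ : ℂ) * c ξ‖ₑ := by
        apply lintegral_mono_ae
        filter_upwards [h0] with ξ hξ
        simp only [enorm_mul]
        rw [ENNReal.tsum_mul_left, ENNReal.tsum_mul_right]
        exact mul_le_mul_right (le_mul_of_one_le_left' (L.one_le_tsum_blockSymbol hξ)) _
    _ = ∑' j : ℤ, ∫⁻ ξ, ‖w ξ‖ₑ * ‖(L.blockSymbol j ξ : ℂ) * c ξ‖ₑ := by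
        refine lintegral_tsum fun j => ?_
        exact (hasTemperateGrowth_japanese _).1.continuous.enorm.aemeasurable.mul
          ((L.hasTemperateGrowth_blockSymbol j).1.continuous.aestronglyMeasurable.mul hc).enorm
    _ ≤ _ := ENNReal.tsum_le_tsum fun j => L.lintegral_japanese_mul_le hσ hc j

/-- A series of tempered distributions with integrable Fourier transforms whose blocks are absolutely
summable in `Ḃ^σ_{2,1}`. -/
theorem sumBesovBound_of_represents (hN : 1 ≤ N) {ι : Type} {σ : ℝ} {F : ι → 𝓢'(Rn N, ℂ)}
    {c : ι → Rn N → ℂ} (hc : ∀ i, Integrable (c i)) (hr : ∀ i, Represents (c i) (𝓕 (F i)))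
    {B : ℝ≥0∞} (hB : B ≠ ⊤)
    (hs : ∑' i, ∑' j : ℤ, (2 : ℝ≥0∞) ^ ((j : ℝ) * σ) *
      eLpNorm (fun ξ => (L.blockSymbol j ξ : ℂ) * c i ξ) 2 volume ≤ B) :
    L.SumBesovBound σ F B := by
  have h2 : ∀ x : ℝ, (2 : ℝ≥0∞) ^ x ≠ 0 := fun x => by simp
  have hcomm := hs
  -- With the sum over `i` inside, each fixed block is an absolutely convergent series in `L²`.
  rw [ENNReal.tsum_comm] at hcomm
  simp only [ENNReal.tsum_mul_left] at hcomm
  have hj : ∀ j : ℤ, ∑' i, eLpNorm (fun ξ => (L.blockSymbol j ξ : ℂ) * c i ξ) 2 volume ≠ ⊤ := by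
    intro j hj
    have h1 := (ENNReal.le_tsum j).trans hcomm
    rw [hj, ENNReal.mul_top (h2 _), top_le_iff] at h1
    exact hB h1
  have hmem : ∀ j i, MemLp (fun ξ => (L.blockSymbol j ξ : ℂ) * c i ξ) 2 volume := fun j i =>
    ⟨(L.hasTemperateGrowth_blockSymbol j).1.continuous.aestronglyMeasurable.mul (hc i).1,
      (ENNReal.le_tsum i).trans_lt (hj j).lt_top⟩
  have hrep : ∀ j i, Represents (fun ξ => (L.blockSymbol j ξ : ℂ) * c i ξ)
      (𝓕 (L.Δ j (F i))) := fun j i =>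
    (hr i).fourierMultiplierCLM (L.hasTemperateGrowth_blockSymbol j)
  choose g G hg hgn hgr hG using fun j => exists_hasSum_of_tsum_eLpNorm (hmem j) (hrep j) (hj j)
  have hbound : ∑' q : ℤ, ENNReal.ofReal ((2 : ℝ) ^ ((q : ℝ) * σ)) * l2Norm (G q) ≤ B := by
    refine (ENNReal.tsum_le_tsum fun q => ?_).trans hcomm
    rw [ofReal_two_rpow, l2Norm_eq_eLpNorm (hgr q) (hg q)]
    exact mul_le_mul_right (hgn q) _
  refine ⟨fun q => (hG q).summable, ?_, fun hσ => ?_⟩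
  · simpa only [(hG _).tsum_eq] using hbound
  set r : ℝ := (N / 2 - σ) / 2
  have hsum : ∑' i, eLpNorm (fun ξ => japanese N (-r) ξ * c i ξ) 1 volume ≠ ⊤ := by
    refine ne_top_of_le_ne_top ?_
      (ENNReal.tsum_le_tsum fun i => L.eLpNorm_japanese_mul_le hN hσ (hc i).1)
    rw [ENNReal.tsum_mul_left]
    exact ENNReal.mul_ne_top (ENNReal.mul_ne_top ENNReal.ofReal_ne_top bernsteinConst_ne_top)
      (ne_top_of_le_ne_top hB hs)
  have hmem1 : ∀ i, MemLp (fun ξ => japanese N (-r) ξ * c i ξ) 1 volume := fun i =>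
    ⟨(hasTemperateGrowth_japanese _).1.continuous.aestronglyMeasurable.mul (hc i).1,
      (ENNReal.le_tsum i).trans_lt hsum.lt_top⟩
  obtain ⟨b, W, -, -, hbr, hW⟩ := exists_hasSum_of_tsum_eLpNorm hmem1
    (fun i => (hr i).fourierMultiplierCLM (hasTemperateGrowth_japanese (-r))) hsum
  -- The weighted series converges to `W`; the inverse multiplier is continuous on `𝓢'` and undoes
  -- the weight.
  have hF : HasSum F (TemperedDistribution.fourierMultiplierCLM ℂ (japanese N r) W) := by
    have h3 := (TemperedDistribution.fourierMultiplierCLM ℂ (japanese N r)).hasSum hW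
    have h4 : ∀ i, TemperedDistribution.fourierMultiplierCLM ℂ (japanese N r)
        (TemperedDistribution.fourierMultiplierCLM ℂ (japanese N (-r)) (F i)) = F i := fun i => by
      rw [TemperedDistribution.fourierMultiplierCLM_fourierMultiplierCLM_apply
        (hasTemperateGrowth_japanese _) (hasTemperateGrowth_japanese _),
        japanese_mul_japanese_neg, TemperedDistribution.fourierMultiplierCLM_const]
      simp
    simpa only [h4] using h3
  refine ⟨_, hF, L.isSh_of_represents hN
    (hbr.fourierMultiplierCLM (hasTemperateGrowth_japanese r)), ?_⟩
  have h5 : ∀ q, L.Δ q (TemperedDistribution.fourierMultiplierCLM ℂ (japanese N r) W) = G q :=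
    fun q => ((L.Δ q).hasSum hF).unique (hG q)
  simpa only [besovNorm, h5] using hbound

end LittlewoodPaley

/-! ### Convolution estimates and spectral localization -/

section Convolution

open scoped Convolution

variable {N : ℕ}

theorem eLpNorm_two_sq (f : Rn N → ℂ) : eLpNorm f 2 volume ^ 2 = ∫⁻ ξ, ‖f ξ‖ₑ ^ 2 := by
  rw [eLpNorm_eq_lintegral_rpow_enorm_toReal (by norm_num) (by norm_num), ← ENNReal.rpow_natCast,
    ← ENNReal.rpow_mul]
  simp

theorem aemeasurable_enorm_sub_left {b : Rn N → ℂ} (hb : AEStronglyMeasurable b volume)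
    (ξ : Rn N) : AEMeasurable (fun η => ‖b (ξ - η)‖ₑ) volume :=
  (hb.comp_measurePreserving (Measure.measurePreserving_sub_left volume ξ)).enorm

theorem enorm_convolution_le_lintegral (a b : Rn N → ℂ) (ξ : Rn N) :
    ‖(a ⋆[ContinuousLinearMap.mul ℂ ℂ] b) ξ‖ₑ ≤ ∫⁻ η, ‖a η‖ₑ * ‖b (ξ - η)‖ₑ := by
  refine (enorm_integral_le_lintegral_enorm _).trans_eq ?_
  simp

/-- Cauchy–Schwarz for the factors `f^{1/2}` and `(f g²)^{1/2}`. -/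
theorem sq_lintegral_mul_le {f g : Rn N → ℝ≥0∞} (hf : AEMeasurable f volume)
    (hg : AEMeasurable g volume) :
    (∫⁻ η, f η * g η) ^ 2 ≤ (∫⁻ η, f η) * ∫⁻ η, f η * g η ^ 2 := by
  have h := ENNReal.lintegral_mul_norm_pow_le (g := fun η => f η * g η ^ 2) hf
    (hf.mul (hg.pow_const 2)) (by norm_num : (0 : ℝ) ≤ 1 / 2)
    (by norm_num : (0 : ℝ) ≤ 1 / 2) (by norm_num)
  have e : ∀ η, f η ^ (1 / 2 : ℝ) * (f η * g η ^ 2) ^ (1 / 2 : ℝ) = f η * g η := fun η => by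
    have e1 : (g η ^ 2) ^ (1 / 2 : ℝ) = g η := by
      rw [← ENNReal.rpow_natCast, ← ENNReal.rpow_mul]
      norm_num
    rw [ENNReal.mul_rpow_of_nonneg _ _ (by norm_num), e1, ← mul_assoc,
      ← ENNReal.rpow_add_of_nonneg _ _ (by norm_num) (by norm_num)]
    norm_num
  have e2 : ∀ x : ℝ≥0∞, (x ^ (1 / 2 : ℝ)) ^ 2 = x := fun x => by
    rw [← ENNReal.rpow_natCast, ← ENNReal.rpow_mul]
    norm_num
  simp only [e] at h
  refine (pow_le_pow_left' h 2).trans_eq ?_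
  rw [mul_pow, e2, e2]

theorem enorm_convolution_le {a b : Rn N → ℂ} (ha : AEStronglyMeasurable a volume)
    (hb : AEStronglyMeasurable b volume) (ξ : Rn N) :
    ‖(a ⋆[ContinuousLinearMap.mul ℂ ℂ] b) ξ‖ₑ ≤ eLpNorm a 2 volume * eLpNorm b 2 volume := by
  refine (enorm_convolution_le_lintegral a b ξ).trans ?_
  refine (ENNReal.lintegral_mul_le_Lp_mul_Lq volume Real.HolderConjugate.two_two ha.enorm
    (aemeasurable_enorm_sub_left hb ξ)).trans_eq ?_
  rw [lintegral_sub_left_eq_self (fun η => ‖b η‖ₑ ^ (2 : ℝ)),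
    eLpNorm_eq_lintegral_rpow_enorm_toReal (by norm_num) (by norm_num),
    eLpNorm_eq_lintegral_rpow_enorm_toReal (by norm_num) (by norm_num)]
  simp

/-- Young's inequality for `L¹ ⋆ L²`. -/
theorem eLpNorm_convolution_le {a b : Rn N → ℂ} (ha : AEStronglyMeasurable a volume)
    (hb : AEStronglyMeasurable b volume) :
    eLpNorm (a ⋆[ContinuousLinearMap.mul ℂ ℂ] b) 2 volume ≤
      eLpNorm a 1 volume * eLpNorm b 2 volume := by
  rw [← ENNReal.pow_le_pow_left_iff two_ne_zero, mul_pow, eLpNorm_two_sq, eLpNorm_two_sq,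
    eLpNorm_one_eq_lintegral_enorm]
  have hm : AEMeasurable (Function.uncurry fun ξ η : Rn N => ‖a η‖ₑ * ‖b (ξ - η)‖ₑ ^ 2)
      (volume.prod volume) :=
    (ha.comp_snd.enorm).mul ((hb.comp_quasiMeasurePreserving
      (quasiMeasurePreserving_sub_of_right_invariant volume volume)).enorm.pow_const 2)
  calc ∫⁻ ξ, ‖(a ⋆[ContinuousLinearMap.mul ℂ ℂ] b) ξ‖ₑ ^ 2
      ≤ ∫⁻ ξ, (∫⁻ η, ‖a η‖ₑ) * ∫⁻ η, ‖a η‖ₑ * ‖b (ξ - η)‖ₑ ^ 2 := by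
        refine lintegral_mono fun ξ => ?_
        exact (pow_le_pow_left' (enorm_convolution_le_lintegral a b ξ) 2).trans
          (sq_lintegral_mul_le ha.enorm (aemeasurable_enorm_sub_left hb ξ))
    _ = (∫⁻ η, ‖a η‖ₑ) * ∫⁻ η, ∫⁻ ξ, ‖a η‖ₑ * ‖b (ξ - η)‖ₑ ^ 2 := by
        rw [← lintegral_lintegral_swap hm]
        exact lintegral_const_mul'' _ hm.lintegral_prod_right'
    _ = (∫⁻ η, ‖a η‖ₑ) * ∫⁻ η, ‖a η‖ₑ * ∫⁻ ξ, ‖b ξ‖ₑ ^ 2 := by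
        congr 1
        refine lintegral_congr fun η => ?_
        rw [← lintegral_sub_right_eq_self (fun ξ => ‖b ξ‖ₑ ^ 2) η]
        exact lintegral_const_mul'' _ (((hb.comp_measurePreserving
          (measurePreserving_sub_right volume η)).enorm).pow_const 2)
    _ = (∫⁻ η, ‖a η‖ₑ) ^ 2 * ∫⁻ ξ, ‖b ξ‖ₑ ^ 2 := by
        rw [lintegral_mul_const'' _ ha.enorm, ← mul_assoc, sq]

theorem convolution_eq_zero {a b : Rn N → ℂ} {ξ : Rn N}
    (h : ∀ η, a η = 0 ∨ b (ξ - η) = 0) : (a ⋆[ContinuousLinearMap.mul ℂ ℂ] b) ξ = 0 := by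
  rw [convolution_def]
  refine integral_eq_zero_of_ae (.of_forall fun η => ?_)
  rcases h η with h | h <;> simp [h]

namespace LittlewoodPaley

variable (L : LittlewoodPaley N)

theorem eLpNorm_blockSymbol_mul_le (j : ℤ) (c : Rn N → ℂ) :
    eLpNorm (fun ξ => (L.blockSymbol j ξ : ℂ) * c ξ) 2 volume ≤ eLpNorm c 2 volume := by
  refine eLpNorm_mono fun ξ => ?_
  rw [norm_mul]
  exact mul_le_of_le_one_left (norm_nonneg _) (L.norm_blockSymbol_le j ξ)

/-- The square root of the ring's volume times the supremum: the Fourier form of the Bernstein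
inequality from `L¹` to `L²`. -/
theorem eLpNorm_blockSymbol_mul_le_of_enorm_le (j : ℤ) {c : Rn N → ℂ} {K : ℝ≥0∞}
    (hc : ∀ ξ, ‖c ξ‖ₑ ≤ K) :
    eLpNorm (fun ξ => (L.blockSymbol j ξ : ℂ) * c ξ) 2 volume ≤
      bernsteinConst N * (2 : ℝ≥0∞) ^ ((j : ℝ) * (N / 2)) * K := by
  have h1 : eLpNorm (fun ξ => (L.blockSymbol j ξ : ℂ) * c ξ) 2 volume ≤
      eLpNorm ((freqRing N j).indicator fun _ => K) 2 volume := by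
    refine eLpNorm_mono_enorm fun ξ => ?_
    by_cases hξ : ξ ∈ freqRing N j
    · rw [Set.indicator_of_mem hξ, enorm_mul, enorm_eq_self]
      refine (mul_le_mul' ?_ (hc ξ)).trans_eq (one_mul K)
      rw [← ofReal_norm]
      exact ENNReal.ofReal_le_one.2 (L.norm_blockSymbol_le j ξ)
    · simp [L.blockSymbol_eq_zero hξ]
  refine h1.trans ?_
  rw [eLpNorm_indicator_const (measurableSet_freqRing j) (by norm_num) (by norm_num),
    enorm_eq_self, mul_comm]
  refine mul_le_mul_left ?_ K
  have := volume_freqRing_rpow_half_le (N := N) j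
  simpa [bernsteinConst, mul_comm] using this

theorem zpow_lt_zpow_of_mul_le {i j : ℤ} {A B : ℝ} {k : ℕ} (hA : 0 < A)
    (h : A * (2 : ℝ) ^ i ≤ B * 2 ^ j) (hk : B < A * 2 ^ k) : i < j + k := by
  have h2 : (0 : ℝ) < 2 ^ j := by positivity
  rw [← zpow_lt_zpow_iff_right₀ (one_lt_two (α := ℝ)), zpow_add₀ two_ne_zero, zpow_natCast]
  have h3 : B * 2 ^ j < A * 2 ^ k * 2 ^ j := mul_lt_mul_of_pos_right hk h2
  nlinarith

/-- Spectral localization of the terms of the paraproduct. -/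
theorem blockSymbol_mul_convolution_eq_zero_of_low {a b : Rn N → ℂ} {j q : ℤ}
    (ha : ∀ ξ, 4 / 3 * (2 : ℝ) ^ (q - 1) < 2 * Real.pi * ‖ξ‖ → a ξ = 0)
    (hb : ∀ ξ, ξ ∉ freqRing N q → b ξ = 0) (hj : j ∉ Set.Icc (q - 5) (q + 2)) (ξ : Rn N) :
    (L.blockSymbol j ξ : ℂ) * (a ⋆[ContinuousLinearMap.mul ℂ ℂ] b) ξ = 0 := by
  by_cases hξ : ξ ∈ freqRing N j
  swap
  · rw [L.blockSymbol_eq_zero hξ, Complex.ofReal_zero, zero_mul]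
  rw [convolution_eq_zero, mul_zero]
  intro η
  by_contra! hc
  have h1 : 2 * Real.pi * ‖η‖ ≤ 4 / 3 * (2 : ℝ) ^ (q - 1) := not_lt.1 fun h => hc.1 (ha η h)
  have h2 : ξ - η ∈ freqRing N q := by
    by_contra h
    exact hc.2 (hb _ h)
  have h3 : (2 : ℝ) ^ (q - 1) = 2 ^ q / 2 := zpow_sub_one₀ two_ne_zero q
  have hpi := Real.two_pi_pos
  have h4 : 2 * Real.pi * ‖ξ‖ ≤ 2 * Real.pi * ‖ξ - η‖ + 2 * Real.pi * ‖η‖ := by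
    rw [← mul_add]
    refine mul_le_mul_of_nonneg_left ?_ hpi.le
    simpa using norm_add_le (ξ - η) η
  have h5 : 2 * Real.pi * ‖ξ - η‖ ≤ 2 * Real.pi * ‖ξ‖ + 2 * Real.pi * ‖η‖ := by
    rw [← mul_add]
    exact mul_le_mul_of_nonneg_left (norm_sub_le ξ η) hpi.le
  rw [h3] at h1
  -- The sum has frequencies between `3/4 - 2/3 = 1/12` and `8/3 + 2/3 = 10/3` times `2 ^ q`. Below,
  -- the exponent `6` is needed: `5` gives equality `32/12 = 8/3`.
  have h6 : j < q + (3 : ℕ) := zpow_lt_zpow_of_mul_le (A := 3 / 4) (B := 10 / 3) (by norm_num)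
    (by linarith [h2.2, hξ.1]) (by norm_num)
  have h7 : q < j + (6 : ℕ) := zpow_lt_zpow_of_mul_le (A := 1 / 12) (B := 8 / 3) (by norm_num)
    (by linarith [h2.1, hξ.2]) (by norm_num)
  apply hj
  constructor <;> push_cast at h6 h7 <;> linarith

/-- Spectral localization of the terms of the remainder. -/
theorem blockSymbol_mul_convolution_eq_zero_of_near {a b : Rn N → ℂ} {j p q : ℤ}
    (ha : ∀ ξ, ξ ∉ freqRing N p → a ξ = 0) (hb : ∀ ξ, ξ ∉ freqRing N q → b ξ = 0)
    (hpq : p ≤ q + 1) (hj : q + 3 < j) (ξ : Rn N) :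
    (L.blockSymbol j ξ : ℂ) * (a ⋆[ContinuousLinearMap.mul ℂ ℂ] b) ξ = 0 := by
  by_cases hξ : ξ ∈ freqRing N j
  swap
  · rw [L.blockSymbol_eq_zero hξ, Complex.ofReal_zero, zero_mul]
  rw [convolution_eq_zero, mul_zero]
  intro η
  by_contra! hc
  have h1 : η ∈ freqRing N p := by
    by_contra h
    exact hc.1 (ha _ h)
  have h2 : ξ - η ∈ freqRing N q := by
    by_contra h
    exact hc.2 (hb _ h)
  have h3 : (2 : ℝ) ^ p ≤ 2 ^ q * 2 := by
    rw [← zpow_add_one₀ two_ne_zero]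
    exact zpow_le_zpow_right₀ one_le_two hpq
  have hpi := Real.two_pi_pos
  have h4 : 2 * Real.pi * ‖ξ‖ ≤ 2 * Real.pi * ‖ξ - η‖ + 2 * Real.pi * ‖η‖ := by
    rw [← mul_add]
    refine mul_le_mul_of_nonneg_left ?_ hpi.le
    simpa using norm_add_le (ξ - η) η
  -- `8 = 8/3 + 2 · 8/3`, since `p` may be `q + 1`. No lower bound on `j` is available: the two
  -- frequencies can cancel.
  have h6 : j < q + (4 : ℕ) := zpow_lt_zpow_of_mul_le (A := 3 / 4) (B := 8) (by norm_num)
    (by linarith [h2.2, h1.2, hξ.1]) (by norm_num)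
  push_cast at h6
  linarith

end LittlewoodPaley

end Convolution

/-! ### Paraproduct and remainder for general weights -/

variable {N : ℕ}

theorem two_rpow_add (x y : ℝ) : (2 : ℝ≥0∞) ^ (x + y) = 2 ^ x * 2 ^ y :=
  ENNReal.rpow_add _ _ (by norm_num) (by norm_num)

theorem two_rpow_ne_zero (x : ℝ) : (2 : ℝ≥0∞) ^ x ≠ 0 := by simp

theorem two_rpow_ne_top (x : ℝ) : (2 : ℝ≥0∞) ^ x ≠ ⊤ :=
  ENNReal.rpow_ne_top_of_ne_zero (by norm_num) (by norm_num)

theorem ne_top_of_tsum_mul_ne_top {ι : Type*} {w f : ι → ℝ≥0∞} (hw : ∀ i, w i ≠ 0)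
    (h : ∑' i, w i * f i ≠ ⊤) (i : ι) : f i ≠ ⊤ := fun hi =>
  ENNReal.ne_top_of_tsum_ne_top h i (by rw [hi, ENNReal.mul_top (hw i)])

/-- The constant from the frequency localization of the terms of the paraproduct. -/
noncomputable def paraConst (σ : ℝ) : ℝ≥0∞ :=
  ∑ k ∈ Finset.Icc (-5 : ℤ) 2, (2 : ℝ≥0∞) ^ ((k : ℝ) * σ)

theorem paraConst_ne_top (σ : ℝ) : paraConst σ ≠ ⊤ :=
  ENNReal.sum_ne_top.2 fun _ _ => two_rpow_ne_top _

/-- The constant from the frequency localization of the terms of the remainder. -/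
noncomputable def remConst (δ : ℝ) : ℝ≥0∞ := ∑' n : ℕ, (2 : ℝ≥0∞) ^ ((3 - (n : ℝ)) * δ)

theorem remConst_ne_top {δ : ℝ} (hδ : 0 < δ) : remConst δ ≠ ⊤ := by
  have e : ∀ n : ℕ, (2 : ℝ≥0∞) ^ ((3 - (n : ℝ)) * δ) = 2 ^ (3 * δ) * ((2 : ℝ≥0∞) ^ (-δ)) ^ n := by
    intro n
    rw [← ENNReal.rpow_natCast, ← ENNReal.rpow_mul, ← two_rpow_add]
    congr 1
    ring
  rw [remConst, tsum_congr e, ENNReal.tsum_mul_left, ENNReal.tsum_geometric]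
  refine ENNReal.mul_ne_top (two_rpow_ne_top _) (ENNReal.inv_ne_top.2 ?_)
  exact (tsub_pos_of_lt (ENNReal.rpow_lt_one_of_one_lt_of_neg (by norm_num) (by linarith))).ne'

theorem tsum_le_paraConst {σ : ℝ} {q : ℤ} {f : ℤ → ℝ≥0∞} {K : ℝ≥0∞} (hf : ∀ j, f j ≤ K)
    (h0 : ∀ j, j ∉ Set.Icc (q - 5) (q + 2) → f j = 0) :
    ∑' j : ℤ, (2 : ℝ≥0∞) ^ ((j : ℝ) * σ) * f j ≤
      paraConst σ * (2 : ℝ≥0∞) ^ ((q : ℝ) * σ) * K := by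
  rw [← (Equiv.addLeft q).tsum_eq, tsum_eq_sum (s := Finset.Icc (-5 : ℤ) 2), paraConst,
    Finset.sum_mul, Finset.sum_mul]
  · refine Finset.sum_le_sum fun k _ => ?_
    rw [Equiv.coe_addLeft, ← two_rpow_add]
    have e : ((q + k : ℤ) : ℝ) * σ = (k : ℝ) * σ + (q : ℝ) * σ := by push_cast; ring
    rw [e]
    exact mul_le_mul_right (hf _) _
  · intro k hk
    rw [Equiv.coe_addLeft, h0, mul_zero]
    intro hm
    apply hk
    rw [Finset.mem_Icc]
    constructor <;> linarith [hm.1, hm.2]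

/-- The substitution `j = q + 3 - n` gives a series in `2^{-nδ}`, descending from the highest block
reached. -/
theorem tsum_le_remConst {δ σ τ : ℝ} (hδ : δ = σ + τ) {q : ℤ} {f : ℤ → ℝ≥0∞} {K : ℝ≥0∞}
    (hf : ∀ j : ℤ, f j ≤ (2 : ℝ≥0∞) ^ ((j : ℝ) * τ) * K) (h0 : ∀ j, q + 3 < j → f j = 0) :
    ∑' j : ℤ, (2 : ℝ≥0∞) ^ ((j : ℝ) * σ) * f j ≤
      remConst δ * (2 : ℝ≥0∞) ^ ((q : ℝ) * δ) * K := by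
  have hinj : Function.Injective fun n : ℕ => q + 3 - (n : ℤ) := fun a b h => by simpa using h
  rw [← hinj.tsum_eq, remConst, ← ENNReal.tsum_mul_right, ← ENNReal.tsum_mul_right]
  · refine ENNReal.tsum_le_tsum fun n => ?_
    refine (mul_le_mul_right (hf _) _).trans_eq ?_
    rw [← mul_assoc, ← two_rpow_add, ← two_rpow_add]
    congr 2
    rw [hδ]
    push_cast
    ring
  · intro j hj
    have hle : j ≤ q + 3 := by
      by_contra hlt
      exact hj (by simp [h0 j (not_le.1 hlt)])
    refine ⟨(q + 3 - j).toNat, ?_⟩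
    change q + 3 - (((q + 3 - j).toNat : ℕ) : ℤ) = j
    rw [Int.toNat_of_nonneg (by linarith)]
    ring

namespace LittlewoodPaley

variable (L : LittlewoodPaley N)

theorem SumBesovBound.mono {L : LittlewoodPaley N} {ι : Type} {σ : ℝ} {F : ι → 𝓢'(Rn N, ℂ)}
    {B B' : ℝ≥0∞} (h : L.SumBesovBound σ F B) (hB : B ≤ B') : L.SumBesovBound σ F B' := by
  refine ⟨h.1, h.2.1.trans hB, fun hσ => ?_⟩
  obtain ⟨T, h1, h2, h3⟩ := h.2.2 hσ
  exact ⟨T, h1, h2, h3.trans hB⟩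

/-- Stated for abstract weights so that both paraproduct estimates follow. In `hw`, the factor
`2^{pN/2}` is the Bernstein cost of block `p` of `u`, and `2^{qσ}` the Besov weight near block `q`
of `v`. -/
theorem sumBesovBound_paraTerm (hN : 1 ≤ N) {σ : ℝ} {wu wv : ℤ → ℝ≥0∞} (hwu : ∀ p, wu p ≠ 0)
    (hwv : ∀ q, wv q ≠ 0) (hwv' : ∀ q, wv q ≠ ⊤)
    (hw : ∀ p q : ℤ, p ≤ q →
      (2 : ℝ≥0∞) ^ ((p : ℝ) * (N / 2)) * (2 : ℝ≥0∞) ^ ((q : ℝ) * σ) ≤ wu p * wv q)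
    {u v : 𝓢'(Rn N, ℂ)} (hu : L.IsSh u) (hU : ∑' p, wu p * l2Norm (L.Δ p u) ≠ ⊤)
    (hV : ∑' q, wv q * l2Norm (L.Δ q v) ≠ ⊤) :
    L.SumBesovBound σ (L.paraTerm u v) (paraConst σ * bernsteinConst N *
      (∑' p, wu p * l2Norm (L.Δ p u)) * ∑' q, wv q * l2Norm (L.Δ q v)) := by
  set U := ∑' p, wu p * l2Norm (L.Δ p u)
  set V := ∑' q, wv q * l2Norm (L.Δ q v) with hVdef
  have hα := ne_top_of_tsum_mul_ne_top hwu hU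
  have hβ := ne_top_of_tsum_mul_ne_top hwv hV
  -- `S_{q-1} u` is made of the blocks `p ≤ q - 2`, whence the index `q - 1 - 1 - n`.
  have hlow : ∀ q : ℤ, (2 : ℝ≥0∞) ^ ((q : ℝ) * σ) * ∑' n : ℕ,
      (2 : ℝ≥0∞) ^ (((q - 1 - 1 - n : ℤ) : ℝ) * (N / 2)) * l2Norm (L.Δ (q - 1 - 1 - n) u) ≤
        wv q * U := by
    intro q
    have hinj : Function.Injective fun n : ℕ => q - 1 - 1 - (n : ℤ) := fun a b h => by
      simpa using h
    have h1 : ∑' n : ℕ, wu (q - 1 - 1 - n) * l2Norm (L.Δ (q - 1 - 1 - n) u) ≤ U :=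
      ENNReal.tsum_comp_le_tsum_of_injective hinj fun p => wu p * l2Norm (L.Δ p u)
    refine le_trans ?_ (mul_le_mul_right h1 (wv q))
    rw [← ENNReal.tsum_mul_left, ← ENNReal.tsum_mul_left]
    refine ENNReal.tsum_le_tsum fun n => ?_
    have h2 := mul_le_mul_left (hw (q - 1 - 1 - n) q (by omega)) (l2Norm (L.Δ (q - 1 - 1 - n) u))
    calc _ = _ := by rw [mul_left_comm, ← mul_assoc]
      _ ≤ _ := h2
      _ = _ := by ring
  have hlowtop : ∀ q : ℤ, ∑' n : ℕ, (2 : ℝ≥0∞) ^ (((q - 1 - 1 - n : ℤ) : ℝ) * (N / 2)) *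
      l2Norm (L.Δ (q - 1 - 1 - n) u) ≠ ⊤ := by
    intro q h
    have h1 := hlow q
    rw [h, ENNReal.mul_top (two_rpow_ne_zero _), top_le_iff] at h1
    exact ENNReal.mul_ne_top (hwv' q) hU h1
  choose a ha har ha0 han using fun q : ℤ => L.exists_fourier_S hu (r := q - 1) hα (hlowtop q)
  choose b hb2 hb hbr hb0 hbn hbn1 using fun q => L.exists_fourier_Δ (hβ q)
  refine L.sumBesovBound_of_represents hN (fun q => (ha q).integrable_convolution _ (hb q))
    (fun q => (har q).fourier_prod (hbr q) (ha q) (hb q)) ?_ ?_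
  · exact ENNReal.mul_ne_top (ENNReal.mul_ne_top (ENNReal.mul_ne_top (paraConst_ne_top σ)
      bernsteinConst_ne_top) hU) hV
  · rw [hVdef, ← ENNReal.tsum_mul_left]
    refine ENNReal.tsum_le_tsum fun q => ?_
    refine (tsum_le_paraConst (q := q) (fun j => ((L.eLpNorm_blockSymbol_mul_le j _).trans
      (eLpNorm_convolution_le (ha q).1 (hb q).1))) fun j hj => ?_).trans ?_
    · rw [funext (L.blockSymbol_mul_convolution_eq_zero_of_low (ha0 q) (hb0 q) hj)]
      exact eLpNorm_zero
    · rw [hbn q]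
      calc _ ≤ paraConst σ * (2 : ℝ≥0∞) ^ ((q : ℝ) * σ) * (bernsteinConst N * (∑' n : ℕ,
              (2 : ℝ≥0∞) ^ (((q - 1 - 1 - n : ℤ) : ℝ) * (N / 2)) *
                l2Norm (L.Δ (q - 1 - 1 - n) u)) * l2Norm (L.Δ q v)) :=
            mul_le_mul_right (mul_le_mul_left (han q) _) _
        _ = paraConst σ * bernsteinConst N * ((2 : ℝ≥0∞) ^ ((q : ℝ) * σ) * ∑' n : ℕ,
              (2 : ℝ≥0∞) ^ (((q - 1 - 1 - n : ℤ) : ℝ) * (N / 2)) *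
                l2Norm (L.Δ (q - 1 - 1 - n) u)) * l2Norm (L.Δ q v) := by ring
        _ ≤ paraConst σ * bernsteinConst N * (wv q * U) * l2Norm (L.Δ q v) :=
            mul_le_mul_left (mul_le_mul_right (hlow q) _) _
        _ = _ := by ring

open scoped Convolution in
theorem tsum_eLpNorm_convolution_le_of_near {σ δ : ℝ} (hσ : δ = σ + N / 2) {a b : Rn N → ℂ}
    {p q : ℤ} (ha : AEStronglyMeasurable a volume) (hb : AEStronglyMeasurable b volume)
    (ha0 : ∀ ξ, ξ ∉ freqRing N p → a ξ = 0) (hb0 : ∀ ξ, ξ ∉ freqRing N q → b ξ = 0)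
    (hpq : p ≤ q + 1) :
    ∑' j : ℤ, (2 : ℝ≥0∞) ^ ((j : ℝ) * σ) * eLpNorm (fun ξ => (L.blockSymbol j ξ : ℂ) *
        (a ⋆[ContinuousLinearMap.mul ℂ ℂ] b) ξ) 2 volume ≤
      remConst δ * bernsteinConst N * (2 : ℝ≥0∞) ^ ((q : ℝ) * δ) *
        (eLpNorm a 2 volume * eLpNorm b 2 volume) := by
  have hest : ∀ j : ℤ, eLpNorm (fun ξ => (L.blockSymbol j ξ : ℂ) *
      (a ⋆[ContinuousLinearMap.mul ℂ ℂ] b) ξ) 2 volume ≤ (2 : ℝ≥0∞) ^ ((j : ℝ) * (N / 2)) *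
        (bernsteinConst N * (eLpNorm a 2 volume * eLpNorm b 2 volume)) := by
    intro j
    refine (L.eLpNorm_blockSymbol_mul_le_of_enorm_le j (enorm_convolution_le ha hb)).trans_eq ?_
    ring
  refine (tsum_le_remConst hσ (q := q) hest fun j hj => ?_).trans_eq ?_
  · rw [funext (L.blockSymbol_mul_convolution_eq_zero_of_near ha0 hb0 hpq hj)]
    exact eLpNorm_zero
  · ring

open scoped Convolution FourierTransform in
theorem sumBesovBound_remTerm (hN : 1 ≤ N) {σ δ : ℝ} (hδ : 0 < δ) (hσ : δ = σ + N / 2)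
    {wu wv : ℤ → ℝ≥0∞} (hwu : ∀ p, wu p ≠ 0) (hwv : ∀ q, wv q ≠ 0) {K : ℝ≥0∞} (hK : K ≠ ⊤)
    (hw : ∀ p q : ℤ, |p - q| ≤ 1 → (2 : ℝ≥0∞) ^ ((q : ℝ) * δ) ≤ K * (wu p * wv q))
    {u v : 𝓢'(Rn N, ℂ)} (hU : ∑' p, wu p * l2Norm (L.Δ p u) ≠ ⊤)
    (hV : ∑' q, wv q * l2Norm (L.Δ q v) ≠ ⊤) :
    L.SumBesovBound σ (L.remTerm u v) (remConst δ * bernsteinConst N * K *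
      (∑' p, wu p * l2Norm (L.Δ p u)) * ∑' q, wv q * l2Norm (L.Δ q v)) := by
  have hα := ne_top_of_tsum_mul_ne_top hwu hU
  have hβ := ne_top_of_tsum_mul_ne_top hwv hV
  choose a ha2 ha har ha0 han han1 using fun q => L.exists_fourier_Δ (hα q)
  choose b hb2 hb hbr hb0 hbn hbn1 using fun q => L.exists_fourier_Δ (hβ q)
  have hc : ∀ pq : {pq : ℤ × ℤ // |pq.1 - pq.2| ≤ 1}, Integrable
      (a pq.1.1 ⋆[ContinuousLinearMap.mul ℂ ℂ] b pq.1.2) := fun pq =>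
    (ha pq.1.1).integrable_convolution _ (hb pq.1.2)
  have hr : ∀ pq : {pq : ℤ × ℤ // |pq.1 - pq.2| ≤ 1}, Represents
      (a pq.1.1 ⋆[ContinuousLinearMap.mul ℂ ℂ] b pq.1.2) (𝓕 (L.remTerm u v pq)) := fun pq =>
    (har pq.1.1).fourier_prod (hbr pq.1.2) (ha pq.1.1) (hb pq.1.2)
  refine L.sumBesovBound_of_represents hN hc hr ?_ ?_
  · exact ENNReal.mul_ne_top (ENNReal.mul_ne_top (ENNReal.mul_ne_top (ENNReal.mul_ne_top
      (remConst_ne_top hδ) bernsteinConst_ne_top) hK) hU) hV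
  · set g : ℤ × ℤ → ℝ≥0∞ := fun pq =>
      (wu pq.1 * l2Norm (L.Δ pq.1 u)) * (wv pq.2 * l2Norm (L.Δ pq.2 v))
    -- Both norms are `ℓ¹` sums, so the near-diagonal sum is simply dominated by the full product.
    have hprod : ∑' pq : {pq : ℤ × ℤ // |pq.1 - pq.2| ≤ 1}, g pq.1 ≤
        (∑' p, wu p * l2Norm (L.Δ p u)) * ∑' q, wv q * l2Norm (L.Δ q v) := by
      refine (ENNReal.tsum_comp_le_tsum_of_injective Subtype.val_injective g).trans_eq ?_
      rw [ENNReal.tsum_prod', ← ENNReal.tsum_mul_right]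
      refine tsum_congr fun p => ?_
      rw [← ENNReal.tsum_mul_left]
    rw [mul_assoc]
    refine le_trans ?_ (mul_le_mul_right hprod _)
    rw [← ENNReal.tsum_mul_left]
    refine ENNReal.tsum_le_tsum fun pq => ?_
    obtain ⟨⟨p, q⟩, hpq⟩ := pq
    dsimp only at hpq ⊢
    refine (L.tsum_eLpNorm_convolution_le_of_near hσ (ha p).1 (hb q).1 (ha0 p) (hb0 q)
      (by linarith [(abs_le.1 hpq).2])).trans ?_
    rw [han, hbn]
    calc remConst δ * bernsteinConst N * (2 : ℝ≥0∞) ^ ((q : ℝ) * δ) *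
          (l2Norm (L.Δ p u) * l2Norm (L.Δ q v))
        ≤ remConst δ * bernsteinConst N * (K * (wu p * wv q)) *
          (l2Norm (L.Δ p u) * l2Norm (L.Δ q v)) :=
          mul_le_mul_left (mul_le_mul_right (hw p q hpq) _) _
      _ = remConst δ * bernsteinConst N * K * (wu p * l2Norm (L.Δ p u) *
          (wv q * l2Norm (L.Δ q v))) := by ring

end LittlewoodPaley

/-! ### Inequalities between hybrid weights, uniform in `μ` -/

/-- The weights of the hybrid norms. -/
noncomputable def hybridWeight (μ s : ℝ) (r : ℝ≥0∞) (q : ℤ) : ℝ≥0∞ :=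
  ENNReal.ofReal ((2 : ℝ) ^ ((q : ℝ) * s) *
    (max μ ((2 : ℝ) ^ (-q))) ^ (1 - 2 * (r⁻¹).toReal))

theorem max_zpow_pos {μ : ℝ} (q : ℤ) : 0 < max μ ((2 : ℝ) ^ (-q)) :=
  lt_max_of_lt_right (by positivity)

theorem hybridWeight_ne_zero (μ s : ℝ) (r : ℝ≥0∞) (q : ℤ) : hybridWeight μ s r q ≠ 0 := by
  have := max_zpow_pos (μ := μ) q
  rw [hybridWeight, Ne, ENNReal.ofReal_eq_zero, not_le]
  positivity

theorem hybridWeight_ne_top (μ s : ℝ) (r : ℝ≥0∞) (q : ℤ) : hybridWeight μ s r q ≠ ⊤ :=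
  ENNReal.ofReal_ne_top

theorem hybridWeight_top (μ s : ℝ) (q : ℤ) : hybridWeight μ s ⊤ q =
    ENNReal.ofReal ((2 : ℝ) ^ ((q : ℝ) * s) * max μ ((2 : ℝ) ^ (-q))) := by
  simp [hybridWeight]

theorem hybridWeight_one (μ s : ℝ) (q : ℤ) : hybridWeight μ s 1 q =
    ENNReal.ofReal ((2 : ℝ) ^ ((q : ℝ) * s) * (max μ ((2 : ℝ) ^ (-q)))⁻¹) := by
  have : (1 : ℝ) - 2 * ((1 : ℝ≥0∞)⁻¹).toReal = -1 := by norm_num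
  rw [hybridWeight, this, Real.rpow_neg_one]

theorem max_zpow_le {μ : ℝ} (p q : ℤ) :
    max μ ((2 : ℝ) ^ (-p)) ≤ 2 ^ (|(q : ℝ) - p|) * max μ ((2 : ℝ) ^ (-q)) := by
  have h1 : (1 : ℝ) ≤ 2 ^ (|(q : ℝ) - p|) := Real.one_le_rpow one_le_two (abs_nonneg _)
  have hm := max_zpow_pos (μ := μ) q
  apply max_le
  · exact (le_max_left _ _).trans (le_mul_of_one_le_left hm.le h1)
  · refine le_trans ?_ (mul_le_mul_of_nonneg_left (le_max_right _ _) (by positivity))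
    rw [← Real.rpow_intCast, ← Real.rpow_intCast, ← Real.rpow_add two_pos]
    apply Real.rpow_le_rpow_of_exponent_le one_le_two
    push_cast
    linarith [le_abs_self ((q : ℝ) - p)]

theorem max_zpow_anti {μ : ℝ} {p q : ℤ} (hpq : p ≤ q) :
    max μ ((2 : ℝ) ^ (-q)) ≤ max μ ((2 : ℝ) ^ (-p)) :=
  max_le_max le_rfl (zpow_le_zpow_right₀ one_le_two (neg_le_neg hpq))

/-- The powers of two compare because `(q - p)(d - s) ≥ 0`, and the quotient of the maxima is at
least `1` by monotonicity. -/
theorem two_rpow_le_hybridWeight_top_mul_one {s t d μ : ℝ} (hs : s ≤ d) {p q : ℤ} (hpq : p ≤ q) :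
    (2 : ℝ≥0∞) ^ ((p : ℝ) * d) * (2 : ℝ≥0∞) ^ ((q : ℝ) * (s + t - d)) ≤
      hybridWeight μ s ⊤ p * hybridWeight μ t 1 q := by
  have hp := max_zpow_pos (μ := μ) p
  have hq := max_zpow_pos (μ := μ) q
  rw [hybridWeight_top, hybridWeight_one, ← two_rpow_add, ← ofReal_two_rpow,
    ← ENNReal.ofReal_mul (by positivity)]
  apply ENNReal.ofReal_le_ofReal
  have h1 : (2 : ℝ) ^ ((p : ℝ) * d + (q : ℝ) * (s + t - d)) ≤
      2 ^ ((p : ℝ) * s) * 2 ^ ((q : ℝ) * t) := by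
    rw [← Real.rpow_add two_pos]
    apply Real.rpow_le_rpow_of_exponent_le one_le_two
    have : (p : ℝ) ≤ q := by exact_mod_cast hpq
    nlinarith
  have h2 : 1 ≤ max μ ((2 : ℝ) ^ (-p)) * (max μ ((2 : ℝ) ^ (-q)))⁻¹ := by
    rw [← div_eq_mul_inv, one_le_div hq]
    exact max_zpow_anti hpq
  calc _ ≤ 2 ^ ((p : ℝ) * s) * 2 ^ ((q : ℝ) * t) *
        (max μ ((2 : ℝ) ^ (-p)) * (max μ ((2 : ℝ) ^ (-q)))⁻¹) :=
        h1.trans (le_mul_of_one_le_right (by positivity) h2)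
    _ = _ := by ring

/-- The quotient of the maxima is now only at least `2^{-(q-p)}`; the gain `2^{(q-p)(d-s)}` with `d
- s ≥ 1` absorbs this loss. -/
theorem two_rpow_le_hybridWeight_one_mul_top {s t d μ : ℝ} (hs : s ≤ d - 1)
    {p q : ℤ} (hpq : p ≤ q) :
    (2 : ℝ≥0∞) ^ ((p : ℝ) * d) * (2 : ℝ≥0∞) ^ ((q : ℝ) * (s + t - d)) ≤
      hybridWeight μ s 1 p * hybridWeight μ t ⊤ q := by
  have hp := max_zpow_pos (μ := μ) p
  have hq := max_zpow_pos (μ := μ) q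
  have hpq' : (p : ℝ) ≤ q := by exact_mod_cast hpq
  rw [hybridWeight_top, hybridWeight_one, ← two_rpow_add, ← ofReal_two_rpow,
    ← ENNReal.ofReal_mul (by positivity)]
  apply ENNReal.ofReal_le_ofReal
  have h1 : (2 : ℝ) ^ ((p : ℝ) * d + (q : ℝ) * (s + t - d)) * 2 ^ (|(q : ℝ) - p|) ≤
      2 ^ ((p : ℝ) * s) * 2 ^ ((q : ℝ) * t) := by
    rw [← Real.rpow_add two_pos, ← Real.rpow_add two_pos, abs_of_nonneg (sub_nonneg.2 hpq')]
    apply Real.rpow_le_rpow_of_exponent_le one_le_two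
    nlinarith
  have h2 : 1 ≤ 2 ^ (|(q : ℝ) - p|) * (max μ ((2 : ℝ) ^ (-q)) * (max μ ((2 : ℝ) ^ (-p)))⁻¹) := by
    rw [← mul_assoc, ← div_eq_mul_inv, one_le_div hp]
    exact max_zpow_le p q
  calc _ ≤ (2 : ℝ) ^ ((p : ℝ) * d + (q : ℝ) * (s + t - d)) * (2 ^ (|(q : ℝ) - p|) *
        (max μ ((2 : ℝ) ^ (-q)) * (max μ ((2 : ℝ) ^ (-p)))⁻¹)) :=
        le_mul_of_one_le_right (by positivity) h2
    _ = (2 : ℝ) ^ ((p : ℝ) * d + (q : ℝ) * (s + t - d)) * 2 ^ (|(q : ℝ) - p|) *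
        (max μ ((2 : ℝ) ^ (-q)) * (max μ ((2 : ℝ) ^ (-p)))⁻¹) := by ring
    _ ≤ 2 ^ ((p : ℝ) * s) * 2 ^ ((q : ℝ) * t) *
        (max μ ((2 : ℝ) ^ (-q)) * (max μ ((2 : ℝ) ^ (-p)))⁻¹) := by gcongr
    _ = _ := by ring

/-- Exchanging `q` for `p` costs `2^{|s|}` in the power and a factor `2` in the maximum. -/
theorem two_rpow_le_hybridWeight_mul_of_near {s t μ : ℝ} {p q : ℤ}
    (hpq : |p - q| ≤ 1) :
    (2 : ℝ≥0∞) ^ ((q : ℝ) * (s + t)) ≤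
      (2 : ℝ≥0∞) ^ (|s| + 1) * (hybridWeight μ s ⊤ p * hybridWeight μ t 1 q) := by
  have hp := max_zpow_pos (μ := μ) p
  have hq := max_zpow_pos (μ := μ) q
  have hpq' : |(p : ℝ) - q| ≤ 1 := by exact_mod_cast hpq
  rw [hybridWeight_top, hybridWeight_one, ← ofReal_two_rpow, ← ofReal_two_rpow,
    ← ENNReal.ofReal_mul (by positivity), ← ENNReal.ofReal_mul (by positivity)]
  apply ENNReal.ofReal_le_ofReal
  have h1 : (2 : ℝ) ^ ((q : ℝ) * (s + t)) ≤
      2 ^ |s| * (2 ^ ((p : ℝ) * s) * 2 ^ ((q : ℝ) * t)) := by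
    rw [← Real.rpow_add two_pos, ← Real.rpow_add two_pos]
    apply Real.rpow_le_rpow_of_exponent_le one_le_two
    have h : -(|(p : ℝ) - q| * |s|) ≤ ((p : ℝ) - q) * s := by
      rw [← abs_mul]
      exact neg_abs_le _
    nlinarith [abs_nonneg s]
  have h2 : 1 ≤ 2 * (max μ ((2 : ℝ) ^ (-p)) * (max μ ((2 : ℝ) ^ (-q)))⁻¹) := by
    rw [← mul_assoc, ← div_eq_mul_inv, one_le_div hq]
    refine (max_zpow_le q p).trans (mul_le_mul_of_nonneg_right ?_ hp.le)
    exact (Real.rpow_le_rpow_of_exponent_le one_le_two hpq').trans_eq (Real.rpow_one 2)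
  calc _ ≤ 2 ^ |s| * (2 ^ ((p : ℝ) * s) * 2 ^ ((q : ℝ) * t)) *
        (2 * (max μ ((2 : ℝ) ^ (-p)) * (max μ ((2 : ℝ) ^ (-q)))⁻¹)) :=
        h1.trans (le_mul_of_one_le_right (by positivity) h2)
    _ = _ := by
        rw [Real.rpow_add two_pos, Real.rpow_one]
        ring

end HybridBesov

theorem proposition2p5 (N : ℕ) (hN : 1 ≤ N) (L : HybridBesov.LittlewoodPaley N) (s t : ℝ) :
    ∃ C : ℝ, 0 < C ∧ ∀ μ : ℝ, 0 < μ → ∀ u v : 𝓢'(HybridBesov.Rn N, ℂ),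
      (s ≤ (N : ℝ) / 2 → L.MemHybrid μ s ⊤ u → L.MemHybrid μ t 1 v →
        L.SumBesovBound (s + t - (N : ℝ) / 2) (L.paraTerm u v)
          (ENNReal.ofReal C * L.hybridNorm μ s ⊤ u * L.hybridNorm μ t 1 v)) ∧
      (s ≤ (N : ℝ) / 2 - 1 → L.MemHybrid μ s 1 u → L.MemHybrid μ t ⊤ v →
        L.SumBesovBound (s + t - (N : ℝ) / 2) (L.paraTerm u v)
          (ENNReal.ofReal C * L.hybridNorm μ s 1 u * L.hybridNorm μ t ⊤ v)) ∧
      (0 < s + t → L.MemHybrid μ s ⊤ u → L.MemHybrid μ t 1 v →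
        L.SumBesovBound (s + t - (N : ℝ) / 2) (L.remTerm u v)
          (ENNReal.ofReal C * L.hybridNorm μ s ⊤ u * L.hybridNorm μ t 1 v)) := by
  open HybridBesov in
  set A : ℝ≥0∞ := paraConst (s + t - (N : ℝ) / 2) * bernsteinConst N
  -- `R` is infinite if `s + t ≤ 0`; `toReal` then gives the harmless value `0`, and `R` is used
  -- only when `s + t > 0`.
  set R : ℝ≥0∞ := remConst (s + t) * bernsteinConst N * (2 : ℝ≥0∞) ^ (|s| + 1)
  have hAtop : A ≠ ⊤ := ENNReal.mul_ne_top (paraConst_ne_top _) bernsteinConst_ne_top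
  have hAC : A ≤ ENNReal.ofReal (A.toReal + R.toReal + 1) := by
    refine ENNReal.le_ofReal_iff_toReal_le hAtop (by positivity) |>.2 ?_
    linarith [R.toReal_nonneg]
  refine ⟨A.toReal + R.toReal + 1, by positivity, fun μ _ u v => ⟨?_, ?_, ?_⟩⟩
  · intro hs hu hv
    refine (L.sumBesovBound_paraTerm hN (hybridWeight_ne_zero μ s ⊤) (hybridWeight_ne_zero μ t 1)
      (hybridWeight_ne_top μ t 1)
      (fun p q hpq => two_rpow_le_hybridWeight_top_mul_one hs hpq) hu.1 hu.2.ne hv.2.ne).mono ?_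
    exact mul_le_mul' (mul_le_mul' hAC le_rfl) le_rfl
  · intro hs hu hv
    refine (L.sumBesovBound_paraTerm hN (hybridWeight_ne_zero μ s 1) (hybridWeight_ne_zero μ t ⊤)
      (hybridWeight_ne_top μ t ⊤)
      (fun p q hpq => two_rpow_le_hybridWeight_one_mul_top hs hpq) hu.1 hu.2.ne hv.2.ne).mono ?_
    exact mul_le_mul' (mul_le_mul' hAC le_rfl) le_rfl
  · intro hst hu hv
    have hRtop : R ≠ ⊤ := ENNReal.mul_ne_top
      (ENNReal.mul_ne_top (remConst_ne_top hst) bernsteinConst_ne_top) (two_rpow_ne_top _)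
    have hRC : R ≤ ENNReal.ofReal (A.toReal + R.toReal + 1) := by
      refine ENNReal.le_ofReal_iff_toReal_le hRtop (by positivity) |>.2 ?_
      linarith [A.toReal_nonneg]
    refine (L.sumBesovBound_remTerm hN hst (by ring) (hybridWeight_ne_zero μ s ⊤)
      (hybridWeight_ne_zero μ t 1) (two_rpow_ne_top _)
      (fun p q hpq => two_rpow_le_hybridWeight_mul_of_near hpq) hu.2.ne hv.2.ne).mono ?_
    exact mul_le_mul' (mul_le_mul' hRC le_rfl) le_rfl
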